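/- For $|x|,|y|,|z|<1$ put $Li_m(z)=\sum_{k\ge1}z^k/k^m$ and $Li_{m,n}(x,y)=\sum_{0<k_1<k_2}\frac{x^{k_1}y^{k_2}}{k_1^m k_2^n}$; elsewhere these are multivalued functions, defined by analytic continuation along paths. Let $S_2=\mathbb C^2\setminus\{xy(1-x)(1-y)(1-xy)=0\}$ and write $\mathcal L_2(z)=\operatorname{Im}Li_2(z)+\arg(1-z)\log|z|$. Consider $$\mathcal L_3(z)=\operatorname{Re}Li_3(z)-\log|z|\operatorname{Re}Li_2(z)-\tfrac13\log^2|z|\,\log|1-z|,$$ $$\begin{aligned}\mathcal L_{1,2}(x,y)=&\operatorname{Re}Li_{1,2}(x,y)-\arg(1-xy)\bigl[\mathcal L_2(x)+\mathcal L_2(y)\bigr]+\log|1-x|\operatorname{Re}Li_2(y)-\log|y|\operatorname{Re}Li_{1,1}(x,y)\\&-\log|1-x^{-1}|\operatorname{Re}Li_2(xy)-\tfrac13\log|xy^2|\log|1-xy|\log|1-x^{-1}|\\&+\tfrac13\log|y|\bigl(2\log|1-y|\log|1-x|+\log|1-xy|\log|1-y|\bigr),\end{aligned}$$ $$\begin{aligned}\mathcal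 L_{2,1}(x,y)=&\operatorname{Re}Li_{2,1}(x,y)+\arg(1-xy)\bigl[\mathcal L_2(x)+\mathcal L_2(y)\bigr]-\arg(1-y)\mathcal L_2(x)+\log|1-y|\operatorname{Re}Li_2(xy)\\&-\log|x|\operatorname{Re}Li_{1,1}(x,y)+\tfrac13\log|1-y|\log|xy|\log|1-xy|\\&+\tfrac13\log|x|\Bigl[\log|1-y|\log|1-x|+\log|1-xy|\log\Bigl|\frac{x(1-y)}{1-x}\Bigr|\Bigr],\end{aligned}$$ where on the open unit disc, respectively on the open unit polydisc, the polylogarithms are given by their power series and the arguments are principal, and where all multivalued functions in a formula (including $\arg(1-\cdot)=\operatorname{Im}\log(1-\cdot)$) are continued simultaneously along the same path inside $\mathbb C\setminus\{0,1\}$, respectively $S_2$. Then these formulas define single-valued real-analytic functions: $\mathcal L_3$ on $\mathbb C\setminus\{0,1\}$, extending continuously to $\mathbb C$, and $\mathcal L_{1,2}$, $\mathcal L_{2,1}$ on $S_2$. That is, there is a real-analytic function (continuously extended to $\mathbb C$ in the case of $\mathcal L_3$) whose value at the end of every such path equals the value of the formula computed with any simultaneous analytic continuation along the path. Moreover, for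 all $(x,y)\in S_2$, $$\mathcal L_{1,2}(x,y)+\mathcal L_{2,1}(y,x)+\mathcal L_3(xy)=0,$$ $$\mathcal L_{2,1}(y,x)=\mathcal L_3(1-xy)+\mathcal L_3(1-x)-\mathcal L_3\Bigl(\frac{1-x}{1-xy}\Bigr)-\mathcal L_3(y)+\mathcal L_3\Bigl(\frac{y-xy}{1-xy}\Bigr)-\mathcal L_3(1).$$ -/

import Mathlib

open Filter Topology

noncomputable section

/-- The power series of the classical polylogarithm, `∑_{k ≥ 1} z ^ k / k ^ m` (for `‖z‖ < 1`). -/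
def polylogSeries (m : ℕ) (z : ℂ) : ℂ :=
  ∑' k : ℕ, z ^ (k + 1) / ((k : ℂ) + 1) ^ m

/-- The power series of the double polylogarithm,
`∑_{0 < k₁ < k₂} x ^ k₁ * y ^ k₂ / (k₁ ^ m * k₂ ^ n)` (for `‖x‖, ‖y‖ < 1`). -/
def doublePolylogSeries (m n : ℕ) (x y : ℂ) : ℂ :=
  ∑' k : {k : ℕ × ℕ // 0 < k.1 ∧ k.1 < k.2},
    x ^ k.1.1 * y ^ k.1.2 / ((k.1.1 : ℂ) ^ m * (k.1.2 : ℂ) ^ n)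

/-- `g` is an analytic continuation of the germ of `f` at `γ 0` along the path `γ`: each `g t`
is holomorphic near `γ t`, `g 0` is the germ of `f`, and for `s` close to `t` the germ
of `g s` at `γ s` is the one defined by `g t`. -/
def ContinuesAlong {E : Type} [NormedAddCommGroup E] [NormedSpace ℂ E]
    (γ : C(unitInterval, E)) (f : E → ℂ) (g : unitInterval → E → ℂ) : Prop :=
  (∀ t, AnalyticAt ℂ (g t) (γ t)) ∧
  g 0 =ᶠ[𝓝 (γ 0)] f ∧
  ∀ t, ∀ᶠ s in 𝓝 t, g s =ᶠ[𝓝 (γ s)] g t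

/-- `F` is the single-valued real-analytic function on `D` given by the expression `expr` in the
multivalued functions indexed by `ι`: these functions are the analytic continuations, inside `D`,
of the functions `start i` on `base`; `F` is real analytic on `D`, and along every path in `D`
that starts in `base`, the value of `F` at the endpoint is the value of `expr` there, computed
from any simultaneous continuation of the functions `start i` along the path. -/
def IsSingleValued {E ι : Type} [NormedAddCommGroup E] [NormedSpace ℂ E] [NormedSpace ℝ E]
    (D base : Set E) (start : ι → E → ℂ) (expr : E → (ι → ℂ) → ℝ) (F : E → ℝ) : Prop :=
  AnalyticOnNhd ℝ F D ∧
  ∀ γ : C(unitInterval, E), γ 0 ∈ base → (∀ t, γ t ∈ D) →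
    ∀ g : ι → unitInterval → E → ℂ, (∀ i, ContinuesAlong γ (start i) (g i)) →
      F (γ 1) = expr (γ 1) (fun i => g i 1 (γ 1))

/-- The multivalued functions `Li₂ z`, `Li₃ z`. -/
inductive TrilogTerm : Type
  | li2 | li3

/-- Their branches on the unit disc. -/
def trilogStart : TrilogTerm → ℂ → ℂ
  | .li2, z => polylogSeries 2 z
  | .li3, z => polylogSeries 3 z

/-- `Re Li₃(z) - log|z| Re Li₂(z) - (1/3) log²|z| log|1-z|`. -/
def trilogExpr (z : ℂ) (v : TrilogTerm → ℂ) : ℝ :=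
  (v .li3).re - Real.log ‖z‖ * (v .li2).re
    - 1 / 3 * Real.log ‖z‖ ^ 2 * Real.log ‖1 - z‖

/-- `L` is the single-valued trilogarithm: real analytic on `ℂ ∖ {0, 1}`, given there by
`trilogExpr`, and extended to `0` and `1` by continuity. -/
def IsSingleValuedTrilog (L : ℂ → ℝ) : Prop :=
  IsSingleValued {z : ℂ | z ≠ 0 ∧ z ≠ 1} {z : ℂ | ‖z‖ < 1} trilogStart trilogExpr L ∧
  Continuous L

/-- `S₂ = ℂ² ∖ {x y (1 - x) (1 - y) (1 - x y) = 0}`. -/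
def S₂ : Set (ℂ × ℂ) :=
  {p | p.1 * p.2 * (1 - p.1) * (1 - p.2) * (1 - p.1 * p.2) ≠ 0}

/-- The open unit polydisc. -/
def polydisc : Set (ℂ × ℂ) := {p | ‖p.1‖ < 1 ∧ ‖p.2‖ < 1}

/-- The multivalued functions `log (1 - x)`, `log (1 - y)`, `log (1 - x y)`, `Li₂ x`, `Li₂ y`,
`Li₂ (x y)`, `Li_{1,1}(x, y)`, `Li_{1,2}(x, y)`, `Li_{2,1}(x, y)`. -/
inductive DoubleTerm : Type
  | logx | logy | logxy | li2x | li2y | li2xy | li11 | li12 | li21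

/-- Their branches on the unit polydisc; the logarithms are the principal ones. -/
def doubleStart : DoubleTerm → ℂ × ℂ → ℂ
  | .logx, p => Complex.log (1 - p.1)
  | .logy, p => Complex.log (1 - p.2)
  | .logxy, p => Complex.log (1 - p.1 * p.2)
  | .li2x, p => polylogSeries 2 p.1
  | .li2y, p => polylogSeries 2 p.2
  | .li2xy, p => polylogSeries 2 (p.1 * p.2)
  | .li11, p => doublePolylogSeries 1 1 p.1 p.2
  | .li12, p => doublePolylogSeries 1 2 p.1 p.2
  | .li21, p => doublePolylogSeries 2 1 p.1 p.2

/-- The single-valued dilogarithm `Im Li₂(z) + arg(1 - z) log|z|`, from the values `l` of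
`log (1 - z)` and `d` of `Li₂ z`. -/
def dilogExpr (z l d : ℂ) : ℝ := d.im + l.im * Real.log ‖z‖

/-- The explicit formula for `𝓛_{1,2}(x, y)`; the arguments of `1 - x`, `1 - y`, `1 - x y` are the
imaginary parts of the corresponding logarithms. -/
def expr12 (p : ℂ × ℂ) (v : DoubleTerm → ℂ) : ℝ :=
  let x := p.1
  let y := p.2
  (v .li12).re
    - (v .logxy).im * (dilogExpr x (v .logx) (v .li2x) + dilogExpr y (v .logy) (v .li2y))
    + Real.log ‖1 - x‖ * (v .li2y).re
    - Real.log ‖y‖ * (v .li11).re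
    - Real.log ‖1 - x⁻¹‖ * (v .li2xy).re
    - 1 / 3 * Real.log ‖x * y ^ 2‖ * Real.log ‖1 - x * y‖ * Real.log ‖1 - x⁻¹‖
    + 1 / 3 * Real.log ‖y‖ * (2 * Real.log ‖1 - y‖ * Real.log ‖1 - x‖
        + Real.log ‖1 - x * y‖ * Real.log ‖1 - y‖)

/-- The explicit formula for `𝓛_{2,1}(x, y)`. -/
def expr21 (p : ℂ × ℂ) (v : DoubleTerm → ℂ) : ℝ :=
  let x := p.1
  let y := p.2
  (v .li21).re
    + (v .logxy).im * (dilogExpr x (v .logx) (v .li2x) + dilogExpr y (v .logy) (v .li2y))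
    - (v .logy).im * dilogExpr x (v .logx) (v .li2x)
    + Real.log ‖1 - y‖ * (v .li2xy).re
    - Real.log ‖x‖ * (v .li11).re
    + 1 / 3 * Real.log ‖1 - y‖ * Real.log ‖x * y‖ * Real.log ‖1 - x * y‖
    + 1 / 3 * Real.log ‖x‖ * (Real.log ‖1 - y‖ * Real.log ‖1 - x‖
        + Real.log ‖1 - x * y‖ * Real.log ‖x * (1 - y) / (1 - x)‖)

/-- `L` is the single-valued real-analytic version `𝓛_{1,2}` of `Li_{1,2}` on `S₂`. -/
def IsSingleValuedLi12 (L : ℂ × ℂ → ℝ) : Prop :=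
  IsSingleValued S₂ polydisc doubleStart expr12 L

/-- `L` is the single-valued real-analytic version `𝓛_{2,1}` of `Li_{2,1}` on `S₂`. -/
def IsSingleValuedLi21 (L : ℂ × ℂ → ℝ) : Prop :=
  IsSingleValued S₂ polydisc doubleStart expr21 L

end

/-!
The key point is that single-valuedness is a consequence of the existence of a global real-analytic
function which agrees with the explicit formula near the base points: along any path, the set of
times at which the two germs agree is open and closed by the identity theorem
(`isSingleValued_of_eqOn`). In the same way a single-valued version is unique on a connected domain
(`IsSingleValued.eqOn`); `S₂` is connected because a complex line through two of its points meets
the complement in finitely many points. So it remains to exhibit global functions and to check the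
formulas for the convergent power series.

For the trilogarithm, `svTrilog` is the formula on the closed unit disc, extended by the inversion
relation `L (z⁻¹) = L z`. Analyticity across the unit circle away from `1` is local: on a small
ball the dilogarithm and the trilogarithm continue as primitives, and the inversion relations for
these branches hold along each outgoing ray, since they hold on the circle and both sides have the
same derivative (`dilogExpr_ray_inv`, `trilogExpr_ray_inv`).

For the double polylogarithms, the right-hand side of the formula for `𝓛_{2,1}(y, x)` in terms
of `𝓛₃` is visibly real analytic on `S₂`; it is taken as the definition of `svLi21`, and `svLi12` is
defined by the relation `𝓛_{1,2}(x, y) + 𝓛_{2,1}(y, x) + 𝓛₃(x y) = 0`. The explicit formula for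
`𝓛_{1,2}` then follows from that for `𝓛_{2,1}` by the stuffle products
(`expr12_add_expr21_add_discTrilog`). For `𝓛_{2,1}` it is enough, again by the identity theorem, to
work on the small open set `fiveTermRegion`, where all arguments lie in the unit disc. This set is
stable under `(x, y) ↦ (t * x, y)`, and along these rays the difference of both sides is constant by
the five-term relation of the Bloch–Wigner dilogarithm (`discDilog_fiveTerm`), itself proved by the
same method; at `t = 0` it vanishes (`polydiscLi21_eq_discTrilog`).
-/

open Filter Topology

noncomputable section

/-! ### Functions given by an expression in analytic continuations -/

/-- By the identity theorem, single-valuedness needs to be checked on `base` only: the set of times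
at which the germ of the global function `F` is the one given by the continuations is open and
closed in the unit interval. -/
theorem isSingleValued_of_eqOn {E ι : Type} [NormedAddCommGroup E] [NormedSpace ℂ E]
    [NormedSpace ℝ E] [Finite ι] {D base : Set E} {start : ι → E → ℂ}
    {expr : E → (ι → ℂ) → ℝ} {F : E → ℝ} (hbase : IsOpen base) (hD : IsOpen D)
    (hexpr : ∀ p ∈ D, ∀ g : ι → E → ℂ, (∀ i, AnalyticAt ℂ (g i) p) →
      AnalyticAt ℝ (fun z => expr z fun i => g i z) p)
    (hF : AnalyticOnNhd ℝ F D)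
    (hFe : ∀ p ∈ D, p ∈ base → F p = expr p fun i => start i p) :
    IsSingleValued D base start expr F := by
  refine ⟨hF, fun γ h0 hγ g hg => ?_⟩
  let G : unitInterval → E → ℝ := fun t z => expr z fun i => g i t z
  let S : Set unitInterval := {t | F =ᶠ[𝓝 (γ t)] G t}
  have hG : ∀ t, AnalyticAt ℝ (G t) (γ t) := fun t =>
    hexpr _ (hγ t) _ fun i => (hg i).1 t
  have hloc : ∀ t, ∀ᶠ s in 𝓝 t, (s ∈ S ↔ t ∈ S) := by
    intro t
    obtain ⟨r, hr, hball⟩ := Metric.eventually_nhds_iff_ball.1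
      ((hG t).eventually_analyticAt.and (hF _ (hγ t)).eventually_analyticAt)
    have hFb : AnalyticOnNhd ℝ F (Metric.ball (γ t) r) := fun z hz => (hball z hz).2
    have hGb : AnalyticOnNhd ℝ (G t) (Metric.ball (γ t) r) := fun z hz => (hball z hz).1
    have hpre : IsPreconnected (Metric.ball (γ t) r) := (convex_ball _ _).isPreconnected
    have hnear : ∀ᶠ s in 𝓝 t, γ s ∈ Metric.ball (γ t) r :=
      γ.continuous.continuousAt.eventually (Metric.ball_mem_nhds _ hr)
    filter_upwards [hnear, eventually_all.2 fun i => (hg i).2.2 t] with s hs hgs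
    have hGs : G s =ᶠ[𝓝 (γ s)] G t := by
      filter_upwards [eventually_all.2 hgs] with z hz
      simp only [G, hz]
    have key : ∀ p ∈ Metric.ball (γ t) r, ∀ q ∈ Metric.ball (γ t) r,
        F =ᶠ[𝓝 p] G t → F =ᶠ[𝓝 q] G t := fun p hp q hq h =>
      (hFb.eqOn_of_preconnected_of_eventuallyEq hGb hpre hp h).eventuallyEq_of_mem
        (Metric.isOpen_ball.mem_nhds hq)
    exact ⟨fun h => key _ hs _ (Metric.mem_ball_self hr) (EventuallyEq.trans h hGs),
      fun h => (key _ (Metric.mem_ball_self hr) _ hs h).trans hGs.symm⟩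
  have hclopen : IsClopen S := by
    constructor
    · rw [← isOpen_compl_iff, isOpen_iff_mem_nhds]
      intro t ht
      filter_upwards [hloc t] with s hs using fun h => ht (hs.1 h)
    · rw [isOpen_iff_mem_nhds]
      intro t ht
      filter_upwards [hloc t] with s hs using hs.2 ht
  have h0S : (0 : unitInterval) ∈ S := by
    filter_upwards [eventually_all.2 fun i => (hg i).2.1, hbase.mem_nhds h0,
      hD.mem_nhds (hγ 0)] with z hz hzb hzD
    simp only [G, hz, hFe z hzD hzb]
  have h1S : (1 : unitInterval) ∈ S := by
    rcases isClopen_iff.1 hclopen with h | h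
    · rw [h] at h0S; exact h0S.elim
    · rw [h]; trivial
  exact EventuallyEq.eq_of_nhds h1S

/-- The value on `base`, read off from a constant path. -/
theorem IsSingleValued.eq_start {E ι : Type} [NormedAddCommGroup E] [NormedSpace ℂ E]
    [NormedSpace ℝ E] {D base : Set E} {start : ι → E → ℂ}
    {expr : E → (ι → ℂ) → ℝ} {F : E → ℝ} (h : IsSingleValued D base start expr F)
    {p : E} (hD : p ∈ D) (hb : p ∈ base) (hs : ∀ i, AnalyticAt ℂ (start i) p) :
    F p = expr p fun i => start i p :=
  h.2 (ContinuousMap.const _ p) hb (fun _ => hD) (fun i _ => start i) fun i =>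
    ⟨fun _ => hs i, EventuallyEq.rfl, fun _ => Eventually.of_forall fun _ => EventuallyEq.rfl⟩

/-- A single-valued version is unique: on `base` it is evaluated along constant paths, and the
identity theorem does the rest. -/
theorem IsSingleValued.eqOn {E ι : Type} [NormedAddCommGroup E] [NormedSpace ℂ E]
    [NormedSpace ℝ E] {D base : Set E} {start : ι → E → ℂ}
    {expr : E → (ι → ℂ) → ℝ} {F F' : E → ℝ} (h : IsSingleValued D base start expr F)
    (h' : IsSingleValued D base start expr F') (hD : IsOpen D) (hb : IsOpen base)
    (hDc : IsPreconnected D) (hne : (D ∩ base).Nonempty)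
    (hs : ∀ p ∈ base, ∀ i, AnalyticAt ℂ (start i) p) : Set.EqOn F F' D := by
  obtain ⟨p, hp⟩ := hne
  refine h.1.eqOn_of_preconnected_of_eventuallyEq h'.1 hDc hp.1 ?_
  filter_upwards [(hD.inter hb).mem_nhds hp] with q hq
  rw [h.eq_start hq.1 hq.2 (hs q hq.2), h'.eq_start hq.1 hq.2 (hs q hq.2)]

theorem analyticAt_log_norm {E : Type*} [NormedAddCommGroup E] [NormedSpace ℝ E] {f : E → ℂ}
    {p : E} (hf : AnalyticAt ℝ f p) (h : f p ≠ 0) :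
    AnalyticAt ℝ (fun z => Real.log ‖f z‖) p := by
  have h1 : (fun z => Real.log ‖f z‖) =
      fun z => 1 / 2 * Real.log ((f z).re ^ 2 + (f z).im ^ 2) := by
    funext z
    have : ‖f z‖ ^ 2 = (f z).re ^ 2 + (f z).im ^ 2 := by
      rw [← Complex.normSq_eq_norm_sq, Complex.normSq_apply]; ring
    rw [← this, Real.log_pow]; push_cast; ring
  have hpos : 0 < (f p).re ^ 2 + (f p).im ^ 2 := by
    have := Complex.normSq_pos.2 h
    rw [Complex.normSq_apply] at this; nlinarith
  have hre : AnalyticAt ℝ (fun z => (f z).re) p := (Complex.reCLM.analyticAt _).comp hf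
  have him : AnalyticAt ℝ (fun z => (f z).im) p := (Complex.imCLM.analyticAt _).comp hf
  rw [h1]
  have hsum : AnalyticAt ℝ (fun z => (f z).re ^ 2 + (f z).im ^ 2) p := (hre.pow 2).add (him.pow 2)
  have hlog := AnalyticAt.comp
    (f := fun z => (f z).re ^ 2 + (f z).im ^ 2) (x := p) (analyticAt_log hpos) hsum
  exact analyticAt_const.mul hlog

theorem analyticAt_re {E : Type*} [NormedAddCommGroup E] [NormedSpace ℝ E] {f : E → ℂ}
    {p : E} (hf : AnalyticAt ℝ f p) : AnalyticAt ℝ (fun z => (f z).re) p :=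
  (Complex.reCLM.analyticAt _).comp hf

theorem analyticAt_im {E : Type*} [NormedAddCommGroup E] [NormedSpace ℝ E] {f : E → ℂ}
    {p : E} (hf : AnalyticAt ℝ f p) : AnalyticAt ℝ (fun z => (f z).im) p :=
  (Complex.imCLM.analyticAt _).comp hf

instance : Finite TrilogTerm :=
  Finite.of_surjective (fun b : Bool => if b then TrilogTerm.li2 else .li3) fun t => by
    cases t
    · exact ⟨true, rfl⟩
    · exact ⟨false, rfl⟩

instance : Finite DoubleTerm :=
  Finite.of_surjective (![.logx, .logy, .logxy, .li2x, .li2y, .li2xy, .li11, .li12, .li21] :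
    Fin 9 → DoubleTerm) fun t => by
    cases t
    exacts [⟨0, rfl⟩, ⟨1, rfl⟩, ⟨2, rfl⟩, ⟨3, rfl⟩, ⟨4, rfl⟩, ⟨5, rfl⟩, ⟨6, rfl⟩, ⟨7, rfl⟩,
      ⟨8, rfl⟩]

theorem mem_S₂_iff {x y : ℂ} :
    (x, y) ∈ S₂ ↔ x ≠ 0 ∧ y ≠ 0 ∧ x ≠ 1 ∧ y ≠ 1 ∧ x * y ≠ 1 := by
  simp only [S₂, Set.mem_ofPred_eq, mul_ne_zero_iff, sub_ne_zero, ne_eq, eq_comm (a := (1 : ℂ)),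
    and_assoc]

theorem isOpen_S₂ : IsOpen S₂ := isOpen_ne_fun (by fun_prop) (by fun_prop)

theorem isOpen_polydisc : IsOpen polydisc :=
  IsOpen.inter (s := {p : ℂ × ℂ | ‖p.1‖ < 1}) (t := {p : ℂ × ℂ | ‖p.2‖ < 1})
    (isOpen_lt (by fun_prop) (by fun_prop)) (isOpen_lt (by fun_prop) (by fun_prop))

theorem analyticAt_trilogExpr {E : Type*} [NormedAddCommGroup E] [NormedSpace ℝ E] {f : E → ℂ}
    {v : E → TrilogTerm → ℂ} {p : E} (hf : AnalyticAt ℝ f p) (h0 : f p ≠ 0) (h1 : f p ≠ 1)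
    (hv : ∀ i, AnalyticAt ℝ (fun q => v q i) p) :
    AnalyticAt ℝ (fun q => trilogExpr (f q) (v q)) p := by
  have hu := analyticAt_log_norm hf h0
  have hl := analyticAt_log_norm (analyticAt_const (v := (1 : ℂ)).sub hf)
    (sub_ne_zero.2 h1.symm)
  exact ((analyticAt_re (hv .li3)).sub (hu.mul (analyticAt_re (hv .li2)))).sub
    ((analyticAt_const.mul (hu.pow 2)).mul hl)

theorem analyticAt_expr (p : ℂ × ℂ) (hp : p ∈ S₂) (g : DoubleTerm → ℂ × ℂ → ℂ)
    (hg : ∀ i, AnalyticAt ℝ (g i) p) :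
    AnalyticAt ℝ (fun z => expr12 z fun i => g i z) p ∧
    AnalyticAt ℝ (fun z => expr21 z fun i => g i z) p := by
  obtain ⟨hx0, hy0, hx1, hy1, hxy1⟩ := mem_S₂_iff.1 hp
  have hx : AnalyticAt ℝ (fun z : ℂ × ℂ => z.1) p := analyticAt_fst
  have hy : AnalyticAt ℝ (fun z : ℂ × ℂ => z.2) p := analyticAt_snd
  have one : AnalyticAt ℝ (fun _ : ℂ × ℂ => (1 : ℂ)) p := analyticAt_const
  have third : AnalyticAt ℝ (fun _ : ℂ × ℂ => (1 / 3 : ℝ)) p := analyticAt_const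
  have two : AnalyticAt ℝ (fun _ : ℂ × ℂ => (2 : ℝ)) p := analyticAt_const
  have hx1' : 1 - p.1 ≠ 0 := sub_ne_zero.2 (Ne.symm hx1)
  have hy1' : 1 - p.2 ≠ 0 := sub_ne_zero.2 (Ne.symm hy1)
  have hxy1' : 1 - p.1 * p.2 ≠ 0 := sub_ne_zero.2 (Ne.symm hxy1)
  have ux := analyticAt_log_norm hx hx0
  have uy := analyticAt_log_norm hy hy0
  have uxy := analyticAt_log_norm (hx.mul hy) (mul_ne_zero hx0 hy0)
  have uxyy := analyticAt_log_norm (hx.mul (hy.pow 2)) (mul_ne_zero hx0 (pow_ne_zero 2 hy0))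
  have lx := analyticAt_log_norm (one.sub hx) hx1'
  have ly := analyticAt_log_norm (one.sub hy) hy1'
  have lxy := analyticAt_log_norm (one.sub (hx.mul hy)) hxy1'
  have lix := analyticAt_log_norm (one.sub (hx.inv hx0))
    (sub_ne_zero.2 fun h => hx1 (inv_eq_one.1 h.symm))
  have q := analyticAt_log_norm ((hx.mul (one.sub hy)).div (one.sub hx) hx1')
    (div_ne_zero (mul_ne_zero hx0 hy1') hx1')
  have re := fun i => analyticAt_re (hg i)
  have im := fun i => analyticAt_im (hg i)
  have dx := (im .li2x).add ((im .logx).mul ux)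
  have dy := (im .li2y).add ((im .logy).mul uy)
  constructor
  · exact ((((((re .li12).sub ((im .logxy).mul (dx.add dy))).add (lx.mul (re .li2y))).sub
      (uy.mul (re .li11))).sub (lix.mul (re .li2xy))).sub
      (((third.mul uxyy).mul lxy).mul lix)).add
      ((third.mul uy).mul (((two.mul ly).mul lx).add (lxy.mul ly)))
  · exact ((((((re .li21).add ((im .logxy).mul (dx.add dy))).sub ((im .logy).mul dx)).add
      (ly.mul (re .li2xy))).sub (ux.mul (re .li11))).add (((third.mul ly).mul uxy).mul lxy)).add
      ((third.mul ux).mul ((ly.mul lx).add (lxy.mul q)))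

/-- Two points of `S₂` lie on a complex line, which meets the complement of `S₂` in finitely many
points; the plane minus finitely many points is connected. -/
theorem isPreconnected_S₂ : IsPreconnected S₂ := by
  refine isPreconnected_of_forall_pair fun p hp q hq => ?_
  let f : ℂ → ℂ × ℂ := fun t => p + t • (q - p)
  let X : Polynomial ℂ := .C p.1 + .X * .C (q.1 - p.1)
  let Y : Polynomial ℂ := .C p.2 + .X * .C (q.2 - p.2)
  let P : Polynomial ℂ := X * Y * (1 - X) * (1 - Y) * (1 - X * Y)
  have hP : ∀ t, f t ∈ S₂ ↔ P.eval t ≠ 0 := by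
    intro t; simp [f, S₂, P, X, Y]
  have h0 : f 0 = p := by simp [f]
  have h1 : f 1 = q := by simp [f]
  have hP0 : P ≠ 0 := by
    intro h
    have := (hP 0).1 (h0 ▸ hp)
    simp [h] at this
  have hfin : {t | P.eval t = 0}.Finite := by
    refine P.roots.toFinset.finite_toSet.subset fun t ht => ?_
    simpa [hP0] using ht
  have hconn : IsPreconnected {t | P.eval t = 0}ᶜ :=
    (hfin.countable.isPathConnected_compl_of_one_lt_rank
      (by simp [Complex.rank_real_complex])).isConnected.isPreconnected
  refine ⟨f '' {t | P.eval t = 0}ᶜ, ?_, ⟨0, (hP 0).1 (h0 ▸ hp), h0⟩,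
    ⟨1, (hP 1).1 (h1 ▸ hq), h1⟩, hconn.image f (by fun_prop)⟩
  rintro _ ⟨t, ht, rfl⟩
  exact (hP t).2 ht

theorem isPreconnected_punctured_disc : IsPreconnected {z : ℂ | z ≠ 0 ∧ ‖z‖ < 1} := by
  have : {z : ℂ | z ≠ 0 ∧ ‖z‖ < 1} = Complex.exp '' {w | w.re < 0} := by
    ext z
    constructor
    · rintro ⟨h0, h1⟩
      refine ⟨Complex.log z, ?_, Complex.exp_log h0⟩
      simpa [Complex.log_re] using Real.log_neg (norm_pos_iff.2 h0) h1
    · rintro ⟨w, hw, rfl⟩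
      exact ⟨Complex.exp_ne_zero _, by simpa [Complex.norm_exp] using hw⟩
  rw [this]
  exact (convex_halfSpace_re_lt 0).isPreconnected.image _ Complex.continuous_exp.continuousOn

theorem isPreconnected_S₂_inter_polydisc : IsPreconnected (S₂ ∩ polydisc) := by
  have : S₂ ∩ polydisc = {z : ℂ | z ≠ 0 ∧ ‖z‖ < 1} ×ˢ {z : ℂ | z ≠ 0 ∧ ‖z‖ < 1} := by
    ext ⟨x, y⟩
    simp only [Set.mem_inter_iff, mem_S₂_iff, polydisc, Set.mem_ofPred_eq, Set.mem_prod]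
    refine ⟨fun h => ⟨⟨h.1.1, h.2.1⟩, h.1.2.1, h.2.2⟩, fun h => ⟨⟨h.1.1, h.2.1, ?_, ?_, ?_⟩,
      h.1.2, h.2.2⟩⟩
    · rintro rfl; simp at h
    · rintro rfl; simp at h
    · intro hxy
      have := mul_lt_one_of_nonneg_of_lt_one_left (norm_nonneg x) h.1.2 h.2.2.le
      rw [← norm_mul, hxy] at this; simp at this
  rw [this]
  exact isPreconnected_punctured_disc.prod isPreconnected_punctured_disc

/-! ### The power series -/

theorem hasDerivAt_tsum_div_mul_pow {c : ℕ → ℂ}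
    (hc : ∀ r : ℝ, 0 ≤ r → r < 1 → Summable fun n => ‖c n‖ * r ^ n) {x : ℂ} (hx : ‖x‖ < 1) :
    HasDerivAt (fun z => ∑' n : ℕ, c n / ((n : ℂ) + 1) * z ^ (n + 1)) (∑' n, c n * x ^ n) x := by
  obtain ⟨r, hxr, hr1⟩ := exists_between hx
  have hr0 : 0 < r := (norm_nonneg x).trans_lt hxr
  refine hasDerivAt_tsum_of_isPreconnected (𝕜 := ℂ) (F := ℂ)
    (g := fun (n : ℕ) (z : ℂ) => c n / ((n : ℂ) + 1) * z ^ (n + 1))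
    (g' := fun (n : ℕ) (z : ℂ) => c n * z ^ n) (hc r hr0.le hr1)
    (t := Metric.ball (0 : ℂ) r) (y₀ := 0) Metric.isOpen_ball (convex_ball _ _).isPreconnected
    (fun n y _ => ?_) (fun n y hy => ?_) (Metric.mem_ball_self hr0) ?_
    (by simpa using hxr)
  · have h := (hasDerivAt_pow (n + 1) y).const_mul (c n / ((n : ℂ) + 1))
    have hn : (n : ℂ) + 1 ≠ 0 := Nat.cast_add_one_ne_zero n
    refine h.congr_deriv ?_
    rw [Nat.add_sub_cancel, Nat.cast_succ, ← mul_assoc, div_mul_cancel₀ _ hn]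
  · rw [norm_mul, norm_pow]
    have : ‖y‖ < r := by simpa using hy
    gcongr
  · simp

theorem norm_mul_lt_one_of_lt {x y : ℂ} (hx : ‖x‖ < 1) (hy : ‖y‖ < 1) : ‖x * y‖ < 1 := by
  rw [norm_mul]; exact mul_lt_one_of_nonneg_of_lt_one_left (norm_nonneg x) hx hy.le

theorem norm_pow_mul_pow_div_le (x y : ℂ) (m n i j : ℕ) :
    ‖x ^ i * y ^ j / ((i : ℂ) ^ m * (j : ℂ) ^ n)‖ ≤ ‖x‖ ^ i * ‖y‖ ^ j := by
  rw [norm_div, norm_mul, norm_mul, norm_pow, norm_pow, norm_pow, norm_pow, Complex.norm_natCast,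
    Complex.norm_natCast]
  rcases eq_or_ne ((i : ℝ) ^ m * (j : ℝ) ^ n) 0 with h | h
  · rw [h, div_zero]; positivity
  · refine div_le_self (by positivity) ?_
    have : ((i ^ m * j ^ n : ℕ) : ℝ) ≠ 0 := by push_cast; exact h
    have h1 : 1 ≤ i ^ m * j ^ n := Nat.one_le_iff_ne_zero.2 (by exact_mod_cast this)
    exact_mod_cast h1

theorem norm_pow_div_le (x : ℂ) (m i : ℕ) : ‖x ^ i / (i : ℂ) ^ m‖ ≤ ‖x‖ ^ i := by
  simpa using norm_pow_mul_pow_div_le x 1 m 0 i 0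

theorem summable_norm_pow_div {x : ℂ} (hx : ‖x‖ < 1) (m : ℕ) :
    Summable fun i : ℕ => ‖x ^ i / (i : ℂ) ^ m‖ :=
  (summable_geometric_of_lt_one (norm_nonneg x) hx).of_nonneg_of_le (fun _ => norm_nonneg _)
    fun _ => norm_pow_div_le x m _

/-- The term of index `0` of the right-hand side is a division by zero. -/
theorem polylogSeries_eq_tsum {x : ℂ} (hx : ‖x‖ < 1) {m : ℕ} (hm : m ≠ 0) :
    polylogSeries m x = ∑' i : ℕ, x ^ i / (i : ℂ) ^ m := by
  rw [(summable_norm_pow_div hx m).of_norm.tsum_eq_zero_add]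
  simp [hm, polylogSeries]

theorem polylogSeries_one {x : ℂ} (hx : ‖x‖ < 1) : polylogSeries 1 x = -Complex.log (1 - x) := by
  rw [polylogSeries_eq_tsum hx one_ne_zero, ← (Complex.hasSum_taylorSeries_neg_log hx).tsum_eq]
  simp

theorem polylogSeries_zero_right (m : ℕ) : polylogSeries m 0 = 0 := by
  simp [polylogSeries]

theorem hasDerivAt_polylogSeries_succ_tsum {x : ℂ} (hx : ‖x‖ < 1) (m : ℕ) :
    HasDerivAt (polylogSeries (m + 1)) (∑' n : ℕ, 1 / ((n : ℂ) + 1) ^ m * x ^ n) x := by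
  have h := hasDerivAt_tsum_div_mul_pow (c := fun n : ℕ => 1 / ((n : ℂ) + 1) ^ m)
    (fun r h0 h1 => (summable_geometric_of_lt_one h0 h1).of_nonneg_of_le
      (fun n => by positivity) fun n => ?_) hx
  · refine h.congr_of_eventuallyEq (Eventually.of_forall fun z => tsum_congr fun n => ?_)
    rw [pow_succ ((n : ℂ) + 1) m, div_div, one_div, div_eq_mul_inv, mul_comm]
  · have := norm_pow_div_le 1 m (n + 1)
    simp only [one_pow, norm_one] at this
    push_cast at this
    exact mul_le_of_le_one_left (by positivity) this

theorem hasDerivAt_polylogSeries_succ {x : ℂ} (hx : ‖x‖ < 1) (h0 : x ≠ 0) (m : ℕ) :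
    HasDerivAt (polylogSeries (m + 1)) (polylogSeries m x / x) x := by
  convert hasDerivAt_polylogSeries_succ_tsum hx m using 1
  rw [polylogSeries, ← tsum_div_const]
  refine tsum_congr fun n => ?_
  rw [pow_succ]
  field_simp

theorem analyticAt_polylogSeries {x : ℂ} (hx : ‖x‖ < 1) (m : ℕ) :
    AnalyticAt ℂ (polylogSeries (m + 1)) x := by
  refine DifferentiableOn.analyticAt (s := Metric.ball 0 1)
    (fun z hz => (hasDerivAt_polylogSeries_succ_tsum (by simpa using hz) m).differentiableAt
      |>.differentiableWithinAt) (Metric.isOpen_ball.mem_nhds (by simpa using hx))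

theorem continuousOn_polylogSeries {m : ℕ} (hm : 2 ≤ m) :
    ContinuousOn (polylogSeries m) (Metric.closedBall 0 1) := by
  have hs : Summable fun k : ℕ => 1 / ((k : ℝ) + 1) ^ m := by
    have := (summable_nat_add_iff 1).2 (Real.summable_one_div_nat_pow.2 hm)
    simpa using this
  refine continuousOn_tsum (fun k => by fun_prop) hs fun k z hz => ?_
  have hz1 : ‖z‖ ≤ 1 := by simpa using hz
  rw [norm_div, norm_pow, norm_pow]
  have h1 : ‖(k : ℂ) + 1‖ = (k : ℝ) + 1 := by
    have := Complex.norm_natCast (k + 1)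
    push_cast at this; exact this
  rw [h1]
  gcongr
  exact pow_le_one₀ (norm_nonneg _) hz1

theorem polylogSeries_conj (m : ℕ) (z : ℂ) :
    polylogSeries m (starRingEnd ℂ z) = starRingEnd ℂ (polylogSeries m z) := by
  rw [polylogSeries, polylogSeries, Complex.conj_tsum]
  refine tsum_congr fun k => ?_
  simp

/-- The coefficient of `x ^ i * y ^ j` in `doublePolylogSeries m n x y`. -/
def doublePolylogCoeff (m n : ℕ) (k : ℕ × ℕ) : ℂ :=
  if 0 < k.1 ∧ k.1 < k.2 then 1 / ((k.1 : ℂ) ^ m * (k.2 : ℂ) ^ n) else 0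

theorem norm_doublePolylogCoeff_le (m n : ℕ) (k : ℕ × ℕ) : ‖doublePolylogCoeff m n k‖ ≤ 1 := by
  unfold doublePolylogCoeff
  split_ifs
  · simpa using norm_pow_mul_pow_div_le 1 1 m n k.1 k.2
  · simp

theorem summable_pow_mul_pow {x y : ℂ} (hx : ‖x‖ < 1) (hy : ‖y‖ < 1) :
    Summable fun k : ℕ × ℕ => ‖x‖ ^ k.1 * ‖y‖ ^ k.2 :=
  (summable_geometric_of_lt_one (norm_nonneg x) hx).mul_of_nonneg
    (summable_geometric_of_lt_one (norm_nonneg y) hy) (fun _ => by positivity)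
    fun _ => by positivity

theorem hasSum_doublePolylogSeries {x y : ℂ} (hx : ‖x‖ < 1) (hy : ‖y‖ < 1) (m n : ℕ) :
    HasSum (fun k : ℕ × ℕ => doublePolylogCoeff m n k * (x ^ k.1 * y ^ k.2))
      (doublePolylogSeries m n x y) := by
  have hs : Summable fun k : ℕ × ℕ => doublePolylogCoeff m n k * (x ^ k.1 * y ^ k.2) := by
    refine .of_norm_bounded (summable_pow_mul_pow hx hy) fun k => ?_
    rw [norm_mul, norm_mul, norm_pow, norm_pow]
    exact mul_le_of_le_one_left (by positivity) (norm_doublePolylogCoeff_le m n k)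
  convert hs.hasSum using 1
  refine (tsum_subtype {k : ℕ × ℕ | 0 < k.1 ∧ k.1 < k.2}
    fun k => x ^ k.1 * y ^ k.2 / ((k.1 : ℂ) ^ m * (k.2 : ℂ) ^ n)).trans ?_
  refine tsum_congr fun k => ?_
  simp only [Set.indicator_apply, Set.mem_ofPred_eq, doublePolylogCoeff]
  split_ifs
  · ring
  · simp

/-- The homogeneous part of degree `d` of `doublePolylogSeries m n`, as a multilinear map on
`ℂ × ℂ`: the monomial `x ^ i * y ^ j` is the product of `i` first and `j` second coordinates. -/
def doublePolylogFPS (m n : ℕ) : FormalMultilinearSeries ℂ (ℂ × ℂ) ℂ := fun d =>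
  ∑ k ∈ Finset.HasAntidiagonal.antidiagonal d, doublePolylogCoeff m n k •
    (ContinuousMultilinearMap.mkPiAlgebraFin ℂ d ℂ).compContinuousLinearMap
      fun i : Fin d => if (i : ℕ) < k.1 then .fst ℂ ℂ ℂ else .snd ℂ ℂ ℂ

theorem prod_ite_lt_eq (x y : ℂ) {d : ℕ} {k : ℕ × ℕ} (hk : k ∈ Finset.HasAntidiagonal.antidiagonal d) :
    ∏ i : Fin d, (if (i : ℕ) < k.1 then x else y) = x ^ k.1 * y ^ k.2 := by
  rw [Finset.HasAntidiagonal.mem_antidiagonal] at hk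
  subst hk
  rw [Fin.prod_univ_add]
  simp

theorem doublePolylogFPS_apply (m n d : ℕ) (p : ℂ × ℂ) :
    (doublePolylogFPS m n d fun _ => p) =
      ∑ k ∈ Finset.HasAntidiagonal.antidiagonal d, doublePolylogCoeff m n k * (p.1 ^ k.1 * p.2 ^ k.2) := by
  simp only [doublePolylogFPS, sum_apply,
    smul_apply, smul_eq_mul]
  refine Finset.sum_congr rfl fun k hk => ?_
  rw [ContinuousMultilinearMap.compContinuousLinearMap_apply,
    ContinuousMultilinearMap.mkPiAlgebraFin_apply, List.prod_ofFn, ← prod_ite_lt_eq _ _ hk]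
  congr 1
  refine Finset.prod_congr rfl fun i _ => ?_
  split_ifs <;> rfl

theorem norm_doublePolylogFPS_le (m n d : ℕ) : ‖doublePolylogFPS m n d‖ ≤ d + 1 := by
  refine (norm_sum_le _ _).trans ?_
  have : ∀ k ∈ Finset.HasAntidiagonal.antidiagonal d, ‖doublePolylogCoeff m n k •
      (ContinuousMultilinearMap.mkPiAlgebraFin ℂ d ℂ).compContinuousLinearMap
      fun i : Fin d => if (i : ℕ) < k.1 then .fst ℂ ℂ ℂ else .snd ℂ ℂ ℂ‖ ≤ 1 := by
    intro k _
    rw [norm_smul]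
    refine mul_le_one₀ (norm_doublePolylogCoeff_le m n k) (norm_nonneg _) ?_
    refine (ContinuousMultilinearMap.norm_compContinuousLinearMap_le _ _).trans ?_
    rw [ContinuousMultilinearMap.norm_mkPiAlgebraFin, one_mul]
    refine Finset.prod_le_one (fun _ _ => norm_nonneg _) fun i _ => ?_
    split_ifs
    · exact ContinuousLinearMap.norm_fst_le ..
    · exact ContinuousLinearMap.norm_snd_le ..
  refine (Finset.sum_le_sum this).trans ?_
  simp

/-- The polydisc is the unit ball of `ℂ × ℂ`, whose norm is the maximum norm, so the double series
is a power series on a ball. -/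
theorem analyticAt_doublePolylogSeries {p : ℂ × ℂ} (hp : p ∈ polydisc) (m n : ℕ) :
    AnalyticAt ℂ (fun q : ℂ × ℂ => doublePolylogSeries m n q.1 q.2) p := by
  have h : HasFPowerSeriesOnBall (fun q : ℂ × ℂ => doublePolylogSeries m n q.1 q.2)
      (doublePolylogFPS m n) 0 1 := by
    refine ⟨?_, by simp, fun {q} hq => ?_⟩
    · refine ENNReal.le_of_forall_nnreal_lt fun r hr => ?_
      have hr1 : (r : ℝ) < 1 := by exact_mod_cast hr
      refine FormalMultilinearSeries.le_radius_of_summable _ ?_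
      have hs : Summable fun d : ℕ => ((d : ℝ) + 1) * (r : ℝ) ^ d := by
        have h1 := summable_pow_mul_geometric_of_norm_lt_one 1 (r := (r : ℝ)) (by simpa using hr1)
        have h2 := summable_geometric_of_lt_one r.coe_nonneg hr1
        refine (h1.add h2).congr fun d => ?_
        ring
      refine hs.of_nonneg_of_le (fun d => by positivity) fun d => ?_
      gcongr
      exact norm_doublePolylogFPS_le m n d
    · have hq1 : max ‖q.1‖ ‖q.2‖ < 1 := by
        rw [← Prod.norm_def]; simpa [enorm_eq_nnnorm, ← NNReal.coe_lt_coe] using hq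
      have hs := hasSum_doublePolylogSeries ((le_max_left _ _).trans_lt hq1)
        ((le_max_right _ _).trans_lt hq1) m n
      have h2 := ((Finset.HasAntidiagonal.sigmaAntidiagonalEquivProd (A := ℕ)).hasSum_iff.2 hs).sigma
        fun d => hasSum_fintype _
      simp only [zero_add]
      refine h2.congr_fun fun d => ?_
      rw [doublePolylogFPS_apply, ← Finset.sum_coe_sort]
      rfl
  refine h.analyticOnNhd p ?_
  have : ‖p‖ < 1 := by rw [Prod.norm_def]; exact max_lt hp.1 hp.2
  simpa [enorm_eq_nnnorm, ← NNReal.coe_lt_coe] using this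

theorem doublePolylogSeries_eq_tsum_pow {x y : ℂ} (hx : ‖x‖ < 1) (hy : ‖y‖ < 1) {m : ℕ}
    (hm : m ≠ 0) :
    doublePolylogSeries m 1 x y = ∑' N : ℕ, (∑ i ∈ Finset.range (N + 1), x ^ i / (i : ℂ) ^ m) /
      ((N : ℂ) + 1) * y ^ (N + 1) := by
  have h := hasSum_doublePolylogSeries hx hy m 1
  have hs : HasSum (fun k : ℕ × ℕ => doublePolylogCoeff m 1 (k.2, k.1) * (x ^ k.2 * y ^ k.1))
      (doublePolylogSeries m 1 x y) := (Equiv.prodComm ℕ ℕ).hasSum_iff.2 h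
  have hrow : ∀ j : ℕ, ∑' i : ℕ, doublePolylogCoeff m 1 (i, j) * (x ^ i * y ^ j) =
      (∑ i ∈ Finset.range j, x ^ i / (i : ℂ) ^ m) / j * y ^ j := by
    intro j
    rw [tsum_eq_sum (s := Finset.range j), Finset.sum_div, Finset.sum_mul]
    · refine Finset.sum_congr rfl fun i hi => ?_
      rw [Finset.mem_range] at hi
      unfold doublePolylogCoeff
      split_ifs with hij
      · simp only [pow_one]; field_simp
      · have : i = 0 := by simp only [not_and] at hij; omega
        simp [this, hm]
    · intro i hi
      rw [Finset.mem_range] at hi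
      simp [doublePolylogCoeff, hi]
  have hsr : Summable fun j : ℕ => ∑' i : ℕ, doublePolylogCoeff m 1 (i, j) * (x ^ i * y ^ j) :=
    hs.summable.prod
  rw [← hs.tsum_eq, hs.summable.tsum_prod, hsr.tsum_eq_zero_add]
  simp only [hrow]
  simp

/-- The coefficients of `polylogSeries m (x * y) / (1 - y)` in `y` are the partial sums
`∑_{i ≤ N} x ^ i / i ^ m`, by multiplication with the geometric series. -/
theorem hasDerivAt_doublePolylogSeries {x y : ℂ} (hx : ‖x‖ < 1) (hy : ‖y‖ < 1) {m : ℕ}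
    (hm : m ≠ 0) :
    HasDerivAt (doublePolylogSeries m 1 x) (polylogSeries m (x * y) / (1 - y)) y := by
  have hsum : ∀ {z : ℂ}, ‖z‖ < 1 → Summable fun i : ℕ => ‖z ^ i‖ := fun hz => by
    simpa only [norm_pow] using summable_geometric_of_lt_one (norm_nonneg _) hz
  have hc : ∀ r : ℝ, 0 ≤ r → r < 1 → Summable fun N : ℕ =>
      ‖∑ i ∈ Finset.range (N + 1), x ^ i / (i : ℂ) ^ m‖ * r ^ N := by
    intro r h0 h1
    have h2 := summable_pow_mul_geometric_of_norm_lt_one 1 (r := r)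
      (by rwa [Real.norm_of_nonneg h0])
    have h3 := summable_geometric_of_lt_one h0 h1
    refine (h2.add h3).of_nonneg_of_le (fun N => by positivity) fun N => ?_
    rw [pow_one, ← add_one_mul]
    gcongr
    refine (norm_sum_le _ _).trans ?_
    refine (Finset.sum_le_card_nsmul _ _ 1 fun i _ =>
      (norm_pow_div_le x m i).trans (pow_le_one₀ (norm_nonneg _) hx.le)).trans ?_
    simp
  have h := hasDerivAt_tsum_div_mul_pow hc hy
  have hxy := norm_mul_lt_one_of_lt hx hy
  have hval : ∑' N : ℕ, (∑ i ∈ Finset.range (N + 1), x ^ i / (i : ℂ) ^ m) * y ^ N =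
      polylogSeries m (x * y) / (1 - y) := by
    rw [polylogSeries_eq_tsum hxy hm, div_eq_mul_inv, ← tsum_geometric_of_norm_lt_one hy,
      tsum_mul_tsum_eq_tsum_sum_antidiagonal_of_summable_norm (summable_norm_pow_div hxy m)
        (hsum hy)]
    refine tsum_congr fun N => ?_
    rw [Finset.Nat.sum_antidiagonal_eq_sum_range_succ_mk, Finset.sum_mul]
    refine Finset.sum_congr rfl fun i hi => ?_
    rw [Finset.mem_range] at hi
    obtain ⟨j, rfl⟩ := Nat.exists_eq_add_of_le (Nat.lt_succ_iff.1 hi)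
    simp only [Nat.add_sub_cancel_left]
    rw [mul_pow, pow_add]
    ring
  rw [hval] at h
  refine h.congr_of_eventuallyEq ?_
  filter_upwards [(isOpen_lt continuous_norm continuous_const).mem_nhds hy] with z hz
  exact doublePolylogSeries_eq_tsum_pow hx hz hm

/-- The stuffle product: the double sum over `(k₁, k₂)` is split according to `k₁ < k₂`,
`k₂ < k₁` and `k₁ = k₂`. -/
theorem polylogSeries_mul_polylogSeries {x y : ℂ} (hx : ‖x‖ < 1) (hy : ‖y‖ < 1) {m n : ℕ}
    (hm : m ≠ 0) (hn : n ≠ 0) :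
    polylogSeries m x * polylogSeries n y =
      doublePolylogSeries m n x y + doublePolylogSeries n m y x + polylogSeries (m + n) (x * y) := by
  have hxy := norm_mul_lt_one_of_lt hx hy
  have h1 := hasSum_doublePolylogSeries hx hy m n
  have h2 : HasSum (fun k : ℕ × ℕ => doublePolylogCoeff n m (k.2, k.1) * (y ^ k.2 * x ^ k.1))
      (doublePolylogSeries n m y x) :=
    (Equiv.prodComm ℕ ℕ).hasSum_iff.2 (hasSum_doublePolylogSeries hy hx n m)
  have h3 : HasSum (fun k : ℕ × ℕ => if k.1 = k.2 then (x * y) ^ k.1 / (k.1 : ℂ) ^ (m + n) else 0)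
      (polylogSeries (m + n) (x * y)) := by
    have hinj : Function.Injective fun i : ℕ => (i, i) := fun i j h => congrArg Prod.fst h
    rw [← hinj.hasSum_iff]
    · rw [polylogSeries_eq_tsum hxy (by omega)]
      simpa [Function.comp_def] using (summable_norm_pow_div hxy (m + n)).of_norm.hasSum
    · rintro ⟨i, j⟩ hij
      simp only [Set.mem_range, Prod.mk.injEq, not_exists, not_and] at hij
      exact if_neg fun h => hij i rfl h
  rw [polylogSeries_eq_tsum hx hm, polylogSeries_eq_tsum hy hn,
    tsum_mul_tsum_of_summable_norm (summable_norm_pow_div hx m) (summable_norm_pow_div hy n)]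
  refine (tsum_congr fun k => ?_).trans ((h1.add h2).add h3).tsum_eq
  obtain ⟨i, j⟩ := k
  simp only [doublePolylogCoeff]
  rcases Nat.eq_zero_or_pos i with rfl | hi
  · rcases Nat.eq_zero_or_pos j with rfl | hj <;> simp [hm, hn]
  rcases Nat.eq_zero_or_pos j with rfl | hj
  · simp [hn]
    omega
  rcases lt_trichotomy i j with h | rfl | h
  · simp only [hi, h, h.not_gt, h.ne, true_and, and_false, if_true, if_false]; ring
  · simp only [lt_irrefl, and_false, if_true, if_false]; ring
  · simp only [hj, h, h.not_gt, h.ne', true_and, and_false, if_true, if_false]; ring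

/-! ### The single-valued dilogarithm and trilogarithm on the unit disc -/

/-- The single-valued dilogarithm (Bloch–Wigner function), for `‖z‖ ≤ 1`. -/
def discDilog (z : ℂ) : ℝ := dilogExpr z (Complex.log (1 - z)) (polylogSeries 2 z)

/-- The single-valued trilogarithm, for `‖z‖ ≤ 1`. -/
def discTrilog (z : ℂ) : ℝ := trilogExpr z fun i => trilogStart i z

theorem discTrilog_eq (z : ℂ) : discTrilog z = (polylogSeries 3 z).re
    - Real.log ‖z‖ * (polylogSeries 2 z).re - 1 / 3 * (Real.log ‖z‖ ^ 2 * Real.log ‖1 - z‖) := by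
  rw [discTrilog, trilogExpr, trilogStart, trilogStart, mul_assoc]

theorem HasDerivAt.complex_re {f : ℝ → ℂ} {f' : ℂ} {t : ℝ} (h : HasDerivAt f f' t) :
    HasDerivAt (fun s => (f s).re) f'.re t :=
  Complex.reCLM.hasFDerivAt.comp_hasDerivAt t h

theorem HasDerivAt.complex_im {f : ℝ → ℂ} {f' : ℂ} {t : ℝ} (h : HasDerivAt f f' t) :
    HasDerivAt (fun s => (f s).im) f'.im t :=
  Complex.imCLM.hasFDerivAt.comp_hasDerivAt t h

theorem hasDerivAt_log_norm {c : ℝ → ℂ} {a : ℂ} {t : ℝ} (h : HasDerivAt c (a * c t) t)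
    (h0 : c t ≠ 0) : HasDerivAt (fun s => Real.log ‖c s‖) a.re t := by
  have hq : HasDerivAt (fun s => c s / c t) a t := by
    simpa [h0] using h.div_const (c t)
  have hlog := (hq.clog_real (by simp [h0])).complex_re.add_const (Real.log ‖c t‖)
  rw [div_self h0, div_one] at hlog
  refine hlog.congr_of_eventuallyEq ?_
  filter_upwards [h.continuousAt.eventually_ne h0] with s hs
  rw [Complex.log_re, norm_div, Real.log_div (norm_ne_zero_iff.2 hs) (norm_ne_zero_iff.2 h0)]
  ring

/-- The differential of a branch of the dilogarithm, along a curve with logarithmic derivatives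
`a` of `c` and `b` of `1 - c`. -/
theorem hasDerivAt_dilogExpr {c : ℝ → ℂ} {a b : ℂ} {t : ℝ} {A₂ : ℂ → ℂ}
    (h : HasDerivAt c (a * c t) t) (hb : -(a * c t) = b * (1 - c t)) (h0 : c t ≠ 0)
    (h1 : 1 - c t ∈ Complex.slitPlane)
    (hA : HasDerivAt A₂ (-Complex.log (1 - c t) / c t) (c t)) :
    HasDerivAt (fun s => dilogExpr (c s) (Complex.log (1 - c s)) (A₂ (c s)))
      (Real.log ‖c t‖ * b.im - Real.log ‖1 - c t‖ * a.im) t := by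
  have h1c := h.const_sub 1
  rw [hb] at h1c
  have hl : HasDerivAt (fun s => Complex.log (1 - c s)) b t := by
    simpa [Complex.slitPlane_ne_zero h1] using h1c.clog_real h1
  have hA' := hA.comp t h
  have h2 := hA'.complex_im.add (hl.complex_im.mul (hasDerivAt_log_norm h h0))
  refine h2.congr_deriv ?_
  have e : -Complex.log (1 - c t) / c t * (a * c t) = -(Complex.log (1 - c t) * a) := by
    field_simp
  rw [e, Complex.neg_im, Complex.mul_im, Complex.log_re]
  ring

/-- The differential of a branch of the trilogarithm involves the branch of the dilogarithm. -/
theorem hasDerivAt_trilogExpr {c : ℝ → ℂ} {a b : ℂ} {t : ℝ} {A₂ A₃ : ℂ → ℂ}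
    (h : HasDerivAt c (a * c t) t) (hb : -(a * c t) = b * (1 - c t)) (h0 : c t ≠ 0)
    (h1 : 1 - c t ≠ 0)
    (hA : HasDerivAt A₂ (-Complex.log (1 - c t) / c t) (c t))
    (hA₃ : HasDerivAt A₃ (A₂ (c t) / c t) (c t)) :
    HasDerivAt (fun s => trilogExpr (c s) fun i => i.rec (A₂ (c s)) (A₃ (c s)))
      (-(a.im * dilogExpr (c t) (Complex.log (1 - c t)) (A₂ (c t))) + 1 / 3 * Real.log ‖c t‖ *
        (Real.log ‖1 - c t‖ * a.re - Real.log ‖c t‖ * b.re)) t := by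
  have h1c := h.const_sub 1
  rw [hb] at h1c
  have hu := hasDerivAt_log_norm h h0
  have hl := hasDerivAt_log_norm (c := fun s => 1 - c s) h1c h1
  have h2 := ((hA₃.comp t h).complex_re.sub (hu.mul (hA.comp t h).complex_re)).sub
    (((hu.pow 2).const_mul (1 / 3)).mul hl)
  refine h2.congr_deriv ?_
  have e : -Complex.log (1 - c t) / c t * (a * c t) = -(Complex.log (1 - c t) * a) := by
    field_simp
  have e' : A₂ (c t) / c t * (a * c t) = A₂ (c t) * a := by
    field_simp
  rw [e, e', Complex.neg_re, Complex.mul_re, Complex.mul_re, Complex.log_re, dilogExpr]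
  simp only [Function.comp_apply, Pi.pow_apply]
  push_cast
  ring

theorem one_sub_mem_slitPlane {z : ℂ} (hz : ‖z‖ ≤ 1) (h1 : z ≠ 1) :
    1 - z ∈ Complex.slitPlane := by
  left
  have h := Complex.re_le_norm z
  rcases (h.trans hz).lt_or_eq with h2 | h2
  · simpa using h2
  · refine (h1 (Complex.ext h2 ?_)).elim
    have h3 : ‖z‖ ^ 2 ≤ 1 := pow_le_one₀ (norm_nonneg z) hz
    rw [← Complex.normSq_eq_norm_sq, Complex.normSq_apply, h2] at h3
    have : z.im * z.im = 0 := le_antisymm (by linarith) (mul_self_nonneg _)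
    simpa using this

theorem hasDerivAt_polylogSeries_two {z : ℂ} (hz : ‖z‖ < 1) (h0 : z ≠ 0) :
    HasDerivAt (polylogSeries 2) (-Complex.log (1 - z) / z) z := by
  rw [← polylogSeries_one hz]
  exact hasDerivAt_polylogSeries_succ hz h0 1

theorem ne_one_of_norm_lt {z : ℂ} (hz : ‖z‖ < 1) : z ≠ 1 := by
  rintro rfl
  simp at hz

theorem hasDerivAt_discDilog {c : ℝ → ℂ} {a b : ℂ} {t : ℝ}
    (h : HasDerivAt c (a * c t) t) (hb : -(a * c t) = b * (1 - c t)) (h0 : c t ≠ 0)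
    (h1 : ‖c t‖ < 1) :
    HasDerivAt (fun s => discDilog (c s))
      (Real.log ‖c t‖ * b.im - Real.log ‖1 - c t‖ * a.im) t :=
  hasDerivAt_dilogExpr h hb h0 (one_sub_mem_slitPlane h1.le (ne_one_of_norm_lt h1))
    (hasDerivAt_polylogSeries_two h1 h0)

theorem hasDerivAt_discTrilog {c : ℝ → ℂ} {a b : ℂ} {t : ℝ}
    (h : HasDerivAt c (a * c t) t) (hb : -(a * c t) = b * (1 - c t)) (h0 : c t ≠ 0)
    (h1 : ‖c t‖ < 1) :
    HasDerivAt (fun s => discTrilog (c s))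
      (-(a.im * discDilog (c t)) + 1 / 3 * Real.log ‖c t‖ *
        (Real.log ‖1 - c t‖ * a.re - Real.log ‖c t‖ * b.re)) t := by
  have := hasDerivAt_trilogExpr h hb h0
    (Complex.slitPlane_ne_zero (one_sub_mem_slitPlane h1.le (ne_one_of_norm_lt h1)))
    (hasDerivAt_polylogSeries_two h1 h0) (hasDerivAt_polylogSeries_succ h1 h0 2)
  exact this

/-! ### Boundary behaviour -/

theorem tendsto_norm_mul_log_norm_pow {n : ℕ} (hn : n = 1 ∨ n = 2) :
    Tendsto (fun z : ℂ => ‖z‖ * Real.log ‖z‖ ^ n) (𝓝 0) (𝓝 0) := by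
  rcases hn with rfl | rfl
  · have : Continuous fun z : ℂ => ‖z‖ * Real.log ‖z‖ :=
      Real.continuous_mul_log.comp continuous_norm
    simpa using this.tendsto 0
  · have h : Continuous fun z : ℂ => 4 * (√‖z‖ * Real.log √‖z‖) ^ 2 :=
      ((Real.continuous_mul_log.comp (Real.continuous_sqrt.comp continuous_norm)).pow 2).const_mul 4
    have e : ∀ z : ℂ, 4 * (√‖z‖ * Real.log √‖z‖) ^ 2 = ‖z‖ * Real.log ‖z‖ ^ 2 := by
      intro z
      rw [Real.log_sqrt (norm_nonneg z), mul_pow, Real.sq_sqrt (norm_nonneg z)]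
      ring
    simp only [e] at h
    simpa using h.tendsto 0

theorem tendsto_log_norm_pow_mul {f : ℂ → ℝ} (hf : f =O[𝓝 0] fun z : ℂ => z) {n : ℕ}
    (hn : n = 1 ∨ n = 2) : Tendsto (fun z => Real.log ‖z‖ ^ n * f z) (𝓝 0) (𝓝 0) := by
  refine ((Asymptotics.isBigO_refl (fun z : ℂ => Real.log ‖z‖ ^ n) (𝓝 0)).mul
    hf.norm_right).trans_tendsto ?_
  simpa only [mul_comm] using tendsto_norm_mul_log_norm_pow hn

theorem isBigO_clog_one_sub : (fun z : ℂ => Complex.log (1 - z)) =O[𝓝 0] fun z : ℂ => z := by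
  have : DifferentiableAt ℂ (fun z : ℂ => Complex.log (1 - z)) 0 :=
    ((differentiableAt_const _).sub differentiableAt_id).clog (by simp)
  simpa using this.isBigO_sub

theorem isBigO_re {f : ℂ → ℂ} {g : ℂ → ℂ} {l : Filter ℂ} (h : f =O[l] g) :
    (fun z => (f z).re) =O[l] g :=
  (Asymptotics.IsBigO.of_bound 1 (Eventually.of_forall fun z => by
    simpa using Complex.abs_re_le_norm (f z))).trans h

theorem isBigO_im {f : ℂ → ℂ} {g : ℂ → ℂ} {l : Filter ℂ} (h : f =O[l] g) :
    (fun z => (f z).im) =O[l] g :=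
  (Asymptotics.IsBigO.of_bound 1 (Eventually.of_forall fun z => by
    simpa using Complex.abs_im_le_norm (f z))).trans h

theorem continuousAt_log_norm {z : ℂ} (h : z ≠ 0) : ContinuousAt (fun z : ℂ => Real.log ‖z‖) z :=
  continuous_norm.continuousAt.log (norm_ne_zero_iff.2 h)

theorem continuous_log_norm_sq_mul_log_norm_one_sub :
    Continuous fun z : ℂ => Real.log ‖z‖ ^ 2 * Real.log ‖1 - z‖ := by
  rw [continuous_iff_continuousAt]
  intro z
  by_cases h0 : z = 0
  · subst h0
    have := tendsto_log_norm_pow_mul (isBigO_re isBigO_clog_one_sub) (Or.inr rfl)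
    simpa [ContinuousAt, Complex.log_re] using this
  by_cases h1 : z = 1
  · subst h1
    -- near `1`, both `log ‖z‖` and its square are `O(1 - z)`
    have hO : (fun z : ℂ => Complex.log (1 - z) ^ 2) =O[𝓝 0] fun z : ℂ => z := by
      have := isBigO_clog_one_sub.mul (isBigO_clog_one_sub.trans
        ((continuous_id.tendsto (0 : ℂ)).isBigO_one ℂ))
      simpa [sq] using this
    have hO' : (fun z : ℂ => Real.log ‖1 - z‖ ^ 2) =O[𝓝 0] fun z : ℂ => z := by
      refine (Asymptotics.IsBigO.of_bound 1 (Eventually.of_forall fun z => ?_)).trans hO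
      rw [one_mul, norm_pow, norm_pow, ← Complex.log_re]
      gcongr
      exact Complex.abs_re_le_norm _
    have h := tendsto_log_norm_pow_mul hO' (Or.inl rfl)
    have hs : Tendsto (fun z : ℂ => 1 - z) (𝓝 1) (𝓝 0) := by
      have : Continuous fun z : ℂ => 1 - z := by fun_prop
      simpa using this.tendsto 1
    simpa [ContinuousAt, Function.comp_def, mul_comm] using h.comp hs
  · exact ((continuousAt_log_norm h0).pow 2).mul
      ((continuousAt_const.sub continuousAt_id).norm.log
        (norm_ne_zero_iff.2 (sub_ne_zero.2 (Ne.symm h1))))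

theorem continuousOn_discTrilog : ContinuousOn discTrilog (Metric.closedBall 0 1) := by
  have hLi : ContinuousOn (fun z => Real.log ‖z‖ * (polylogSeries 2 z).re)
      (Metric.closedBall 0 1) := by
    intro z hz
    by_cases h0 : z = 0
    · subst h0
      have hd : (fun z : ℂ => polylogSeries 2 z) =O[𝓝 0] fun z : ℂ => z := by
        simpa [polylogSeries_zero_right] using
          (analyticAt_polylogSeries (x := 0) (by simp) 1).differentiableAt.isBigO_sub
      refine ContinuousAt.continuousWithinAt ?_
      simpa [ContinuousAt] using tendsto_log_norm_pow_mul (isBigO_re hd) (Or.inl rfl)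
    · exact (continuousAt_log_norm h0).continuousWithinAt.mul
        (Complex.continuous_re.continuousAt.comp_continuousWithinAt
          (continuousOn_polylogSeries le_rfl z hz))
  refine ContinuousOn.congr (((Complex.continuous_re.comp_continuousOn
    (continuousOn_polylogSeries (by norm_num : 2 ≤ 3))).sub hLi).sub
      (continuous_log_norm_sq_mul_log_norm_one_sub.continuousOn.const_mul (1 / 3)))
    fun z _ => discTrilog_eq z

theorem continuousOn_discDilog : ContinuousOn discDilog (Metric.closedBall 0 1) := by
  refine (Complex.continuous_im.comp_continuousOn (continuousOn_polylogSeries le_rfl)).add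
    fun z hz => ContinuousAt.continuousWithinAt ?_
  by_cases h0 : z = 0
  · subst h0
    simpa [ContinuousAt, mul_comm] using
      tendsto_log_norm_pow_mul (isBigO_im isBigO_clog_one_sub) (Or.inl rfl)
  by_cases h1 : z = 1
  · subst h1
    have h : Tendsto (fun z : ℂ => Real.pi * |Real.log ‖z‖|) (𝓝 1) (𝓝 0) := by
      simpa using ((continuousAt_log_norm one_ne_zero).abs.const_mul Real.pi).tendsto
    have := squeeze_zero_norm (fun z => ?_) h (f := fun z : ℂ =>
      (Complex.log (1 - z)).im * Real.log ‖z‖)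
    · simpa [ContinuousAt] using this
    · rw [norm_mul]
      exact mul_le_mul_of_nonneg_right (by simpa [Complex.log_im] using Complex.abs_arg_le_pi _)
        (norm_nonneg _)
  · exact (Complex.continuous_im.continuousAt.comp
      ((continuousAt_const.sub continuousAt_id).clog
        (one_sub_mem_slitPlane (by simpa using hz) h1))).mul (continuousAt_log_norm h0)

theorem discDilog_zero : discDilog 0 = 0 := by
  simp [discDilog, dilogExpr, polylogSeries_zero_right]

theorem polylogSeries_im_one (m : ℕ) : (polylogSeries m 1).im = 0 := by
  have := congrArg Complex.im (polylogSeries_conj m 1)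
  rw [map_one, Complex.conj_im] at this
  linarith

theorem discDilog_one : discDilog 1 = 0 := by
  simp [discDilog, dilogExpr, polylogSeries_im_one]

theorem eq_of_hasDerivAt_zero {f : ℝ → ℝ} {a b : ℝ} (hab : a < b)
    (hf : ContinuousOn f (Set.Icc a b)) (hf' : ∀ t ∈ Set.Ioo a b, HasDerivAt f 0 t) :
    f b = f a := by
  obtain ⟨c, -, hc⟩ := exists_hasDerivAt_eq_slope f (fun _ => 0) hab hf hf'
  rw [eq_comm, div_eq_zero_iff, sub_eq_zero] at hc
  exact hc.resolve_right (sub_pos.2 hab).ne'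

/-! ### The single-valued trilogarithm on the plane -/

/-- The single-valued trilogarithm: on the exterior of the unit disc it is given by the inversion
relation `L (z⁻¹) = L z`. -/
def svTrilog (z : ℂ) : ℝ := if ‖z‖ ≤ 1 then discTrilog z else discTrilog z⁻¹

theorem svTrilog_of_norm_le {z : ℂ} (hz : ‖z‖ ≤ 1) : svTrilog z = discTrilog z := if_pos hz

theorem inv_eq_conj_of_norm_eq_one {z : ℂ} (hz : ‖z‖ = 1) : z⁻¹ = starRingEnd ℂ z := by
  rw [Complex.inv_def, Complex.normSq_eq_norm_sq, hz]; simp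

theorem discTrilog_inv_of_norm_eq_one {z : ℂ} (hz : ‖z‖ = 1) :
    discTrilog z⁻¹ = discTrilog z := by
  rw [discTrilog_eq, discTrilog_eq, norm_inv, hz, inv_eq_conj_of_norm_eq_one hz,
    polylogSeries_conj]
  simp

theorem svTrilog_of_one_le_norm {z : ℂ} (hz : 1 ≤ ‖z‖) : svTrilog z = discTrilog z⁻¹ := by
  rcases hz.lt_or_eq with h | h
  · exact if_neg (not_le.2 h)
  · rw [svTrilog_of_norm_le h.symm.le, discTrilog_inv_of_norm_eq_one h.symm]

theorem norm_inv_le_one {z : ℂ} (hz : 1 ≤ ‖z‖) : ‖z⁻¹‖ ≤ 1 := by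
  rw [norm_inv]; exact inv_le_one_of_one_le₀ hz

theorem continuous_svTrilog : Continuous svTrilog := by
  refine continuous_if_le continuous_norm continuous_const ?_ ?_ fun z hz =>
    (discTrilog_inv_of_norm_eq_one hz).symm
  · refine continuousOn_discTrilog.mono fun z hz => ?_
    simpa using hz
  · refine continuousOn_discTrilog.comp (continuousOn_inv₀.mono fun z hz => ?_) fun z hz => ?_
    · have : 1 ≤ ‖z‖ := hz
      exact norm_pos_iff.1 (by linarith)
    · simpa using norm_inv_le_one (show 1 ≤ ‖z‖ from hz)

theorem analyticAt_trilogStart {z : ℂ} (hz : ‖z‖ < 1) (i : TrilogTerm) :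
    AnalyticAt ℂ (trilogStart i) z := by
  cases i
  · exact analyticAt_polylogSeries hz 1
  · exact analyticAt_polylogSeries hz 2

theorem analyticAt_discTrilog {z : ℂ} (hz : ‖z‖ < 1) (h0 : z ≠ 0) :
    AnalyticAt ℝ discTrilog z :=
  analyticAt_trilogExpr analyticAt_id h0 (ne_one_of_norm_lt hz)
    fun i => (analyticAt_trilogStart hz i).restrictScalars

section Ray

variable {A₂ A₃ : ℂ → ℂ} {u : ℂ} {R : ℝ}

theorem hasDerivAt_ofReal_mul (u : ℂ) {t : ℝ} (ht : 0 < t) :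
    HasDerivAt (fun s : ℝ => (s : ℂ) * u) ((t : ℂ)⁻¹ * ((t : ℂ) * u)) t := by
  have ht' : (t : ℂ) ≠ 0 := Complex.ofReal_ne_zero.2 ht.ne'
  have h := (HasDerivAt.ofReal_comp (hasDerivAt_id t)).mul_const u
  refine h.congr_deriv ?_
  simp only [Complex.ofReal_one]
  field_simp

theorem hasDerivAt_ofReal_mul_inv {u : ℂ} (hu : u ≠ 0) {t : ℝ} (ht : 0 < t) :
    HasDerivAt (fun s : ℝ => ((s : ℂ) * u)⁻¹) (-(t : ℂ)⁻¹ * ((t : ℂ) * u)⁻¹) t := by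
  have ht' : (t : ℂ) ≠ 0 := Complex.ofReal_ne_zero.2 ht.ne'
  refine ((hasDerivAt_ofReal_mul u ht).fun_inv (mul_ne_zero ht' hu)).congr_deriv ?_
  field_simp

theorem norm_ofReal_mul_of_norm_eq_one (hu : ‖u‖ = 1) {t : ℝ} (ht : 1 ≤ t) :
    ‖(t : ℂ) * u‖ = t := by
  rw [norm_mul, hu, mul_one, Complex.norm_real, Real.norm_of_nonneg (by linarith)]

theorem log_norm_one_sub_inv {z : ℂ} (h0 : z ≠ 0) (h1 : 1 - z ≠ 0) :
    Real.log ‖1 - z⁻¹‖ = Real.log ‖1 - z‖ - Real.log ‖z‖ := by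
  have : 1 - z⁻¹ = -((1 - z) / z) := by field_simp; ring
  rw [this, norm_neg, norm_div, Real.log_div (norm_ne_zero_iff.2 h1) (norm_ne_zero_iff.2 h0)]

theorem continuousOn_and_mapsTo_ray_inv (hu : ‖u‖ = 1) :
    ContinuousOn (fun t : ℝ => ((t : ℂ) * u)⁻¹) (Set.Icc 1 R) ∧
    Set.MapsTo (fun t : ℝ => ((t : ℂ) * u)⁻¹) (Set.Icc 1 R) (Metric.closedBall 0 1) := by
  constructor
  · refine ContinuousOn.inv₀ (by fun_prop) fun t ht h => ?_
    have := norm_ofReal_mul_of_norm_eq_one hu ht.1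
    rw [h, norm_zero] at this
    linarith [ht.1]
  · intro t ht
    have h : 1 ≤ ‖(t : ℂ) * u‖ := by rw [norm_ofReal_mul_of_norm_eq_one hu ht.1]; exact ht.1
    simpa using norm_inv_le_one h

/-- Inversion relation for a branch of the dilogarithm continued along a ray that leaves the unit
disc at `u`. -/
theorem dilogExpr_ray_inv (hu : ‖u‖ = 1)
    (hslit : ∀ t : ℝ, t ∈ Set.Icc 1 R → 1 - (t : ℂ) * u ∈ Complex.slitPlane)
    (hA₂ : ∀ t : ℝ, t ∈ Set.Icc 1 R →
      HasDerivAt A₂ (-Complex.log (1 - (t : ℂ) * u) / ((t : ℂ) * u)) ((t : ℂ) * u))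
    (h₂ : A₂ u = polylogSeries 2 u) {r : ℝ} (hr1 : 1 ≤ r) (hrR : r ≤ R) :
    dilogExpr ((r : ℂ) * u) (Complex.log (1 - (r : ℂ) * u)) (A₂ ((r : ℂ) * u)) =
      -discDilog ((r : ℂ) * u)⁻¹ := by
  have hu0 : u ≠ 0 := by rintro rfl; simp at hu
  let f : ℝ → ℝ := fun t => dilogExpr ((t : ℂ) * u) (Complex.log (1 - (t : ℂ) * u))
    (A₂ ((t : ℂ) * u)) + discDilog ((t : ℂ) * u)⁻¹
  have h1 : f 1 = 0 := by
    simp only [f, discDilog, dilogExpr, Complex.ofReal_one, one_mul, norm_inv, hu, inv_one,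
      Real.log_one, mul_zero, add_zero, h₂, inv_eq_conj_of_norm_eq_one hu, polylogSeries_conj,
      Complex.conj_im, add_neg_cancel]
  suffices f r = 0 from eq_neg_of_add_eq_zero_left this
  rcases hr1.eq_or_lt with rfl | hr1
  · exact h1
  rw [← h1]
  have hne : ∀ t : ℝ, 1 ≤ t → (t : ℂ) * u ≠ 0 := fun t ht =>
    mul_ne_zero (Complex.ofReal_ne_zero.2 (by linarith)) hu0
  have hsub : ∀ t ∈ Set.Icc 1 r, t ∈ Set.Icc 1 R := fun t ht => ⟨ht.1, ht.2.trans hrR⟩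
  have hd : ∀ t ∈ Set.Icc 1 r, HasDerivAt (fun t : ℝ => dilogExpr ((t : ℂ) * u)
      (Complex.log (1 - (t : ℂ) * u)) (A₂ ((t : ℂ) * u))) (Real.log ‖(t : ℂ) * u‖ *
        (-((t : ℂ)⁻¹ * ((t : ℂ) * u)) / (1 - (t : ℂ) * u)).im -
        Real.log ‖1 - (t : ℂ) * u‖ * ((t : ℂ)⁻¹).im) t := fun t ht => by
    refine hasDerivAt_dilogExpr (c := fun t : ℝ => (t : ℂ) * u)
      (hasDerivAt_ofReal_mul u (by linarith [ht.1])) ?_ (hne t ht.1)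
      (hslit t (hsub t ht)) (hA₂ t (hsub t ht))
    rw [div_mul_cancel₀ _ (Complex.slitPlane_ne_zero (hslit t (hsub t ht)))]
  refine eq_of_hasDerivAt_zero hr1 (ContinuousOn.add
    (fun t ht => (hd t ht).continuousAt.continuousWithinAt)
    (continuousOn_discDilog.comp (continuousOn_and_mapsTo_ray_inv hu).1
      (continuousOn_and_mapsTo_ray_inv hu).2)) fun t ht => ?_
  have ht1 : 1 < t := ht.1
  have htI : t ∈ Set.Icc 1 r := ⟨ht.1.le, ht.2.le⟩
  have ht0 : (t : ℂ) ≠ 0 := Complex.ofReal_ne_zero.2 (by linarith)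
  have h1s := Complex.slitPlane_ne_zero (hslit t (hsub t htI))
  have hinv := hasDerivAt_discDilog (c := fun t : ℝ => ((t : ℂ) * u)⁻¹)
    (b := -((t : ℂ)⁻¹ * ((t : ℂ) * u)) / (1 - (t : ℂ) * u) - (t : ℂ)⁻¹)
    (hasDerivAt_ofReal_mul_inv hu0 (by linarith))
    (by field_simp; ring) (inv_ne_zero (hne t ht1.le)) (by
      rw [norm_inv, norm_ofReal_mul_of_norm_eq_one hu ht1.le]; exact inv_lt_one_of_one_lt₀ ht1)
  refine ((hd t htI).add hinv).congr_deriv ?_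
  rw [log_norm_one_sub_inv (hne t ht1.le) h1s, norm_inv, Real.log_inv, Complex.sub_im,
    Complex.neg_im]
  ring

/-- Inversion relation for a branch of the trilogarithm continued along a ray that leaves the unit
disc at `u`. -/
theorem trilogExpr_ray_inv (hu : ‖u‖ = 1)
    (hslit : ∀ t : ℝ, t ∈ Set.Icc 1 R → 1 - (t : ℂ) * u ∈ Complex.slitPlane)
    (hA₂ : ∀ t : ℝ, t ∈ Set.Icc 1 R →
      HasDerivAt A₂ (-Complex.log (1 - (t : ℂ) * u) / ((t : ℂ) * u)) ((t : ℂ) * u))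
    (h₂ : A₂ u = polylogSeries 2 u)
    (hA₃ : ∀ t : ℝ, t ∈ Set.Icc 1 R →
      HasDerivAt A₃ (A₂ ((t : ℂ) * u) / ((t : ℂ) * u)) ((t : ℂ) * u))
    (h₃ : A₃ u = polylogSeries 3 u) (hR : 1 ≤ R) :
    trilogExpr ((R : ℂ) * u) (fun i => i.rec (A₂ ((R : ℂ) * u)) (A₃ ((R : ℂ) * u))) =
      discTrilog ((R : ℂ) * u)⁻¹ := by
  have hu0 : u ≠ 0 := by rintro rfl; simp at hu
  let f : ℝ → ℝ := fun t => trilogExpr ((t : ℂ) * u) (fun i => i.rec (A₂ ((t : ℂ) * u))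
    (A₃ ((t : ℂ) * u))) - discTrilog ((t : ℂ) * u)⁻¹
  have h1 : f 1 = 0 := by
    simp only [f]
    rw [Complex.ofReal_one, one_mul, discTrilog_inv_of_norm_eq_one hu, discTrilog_eq, trilogExpr,
      hu, Real.log_one, h₃]
    ring
  suffices f R = 0 from sub_eq_zero.1 this
  rcases hR.eq_or_lt with rfl | hR
  · exact h1
  rw [← h1]
  have hne : ∀ t : ℝ, 1 ≤ t → (t : ℂ) * u ≠ 0 := fun t ht =>
    mul_ne_zero (Complex.ofReal_ne_zero.2 (by linarith)) hu0
  have hd := fun (t : ℝ) (ht : t ∈ Set.Icc 1 R) =>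
    hasDerivAt_trilogExpr (c := fun t : ℝ => (t : ℂ) * u) (A₂ := A₂) (A₃ := A₃)
      (b := -((t : ℂ)⁻¹ * ((t : ℂ) * u)) / (1 - (t : ℂ) * u))
      (hasDerivAt_ofReal_mul u (by linarith [ht.1]))
      (by rw [div_mul_cancel₀ _ (Complex.slitPlane_ne_zero (hslit t ht))]) (hne t ht.1)
      (Complex.slitPlane_ne_zero (hslit t ht)) (hA₂ t ht) (hA₃ t ht)
  refine eq_of_hasDerivAt_zero hR (ContinuousOn.sub
    (fun t ht => (hd t ht).continuousAt.continuousWithinAt)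
    (continuousOn_discTrilog.comp (continuousOn_and_mapsTo_ray_inv hu).1
      (continuousOn_and_mapsTo_ray_inv hu).2)) fun t ht => ?_
  have ht1 : 1 < t := ht.1
  have htI : t ∈ Set.Icc 1 R := ⟨ht.1.le, ht.2.le⟩
  have ht0 : (t : ℂ) ≠ 0 := Complex.ofReal_ne_zero.2 (by linarith)
  have h1s := Complex.slitPlane_ne_zero (hslit t htI)
  have hinv := hasDerivAt_discTrilog (c := fun t : ℝ => ((t : ℂ) * u)⁻¹)
    (b := -((t : ℂ)⁻¹ * ((t : ℂ) * u)) / (1 - (t : ℂ) * u) - (t : ℂ)⁻¹)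
    (hasDerivAt_ofReal_mul_inv hu0 (by linarith))
    (by field_simp; ring) (inv_ne_zero (hne t ht1.le)) (by
      rw [norm_inv, norm_ofReal_mul_of_norm_eq_one hu ht1.le]; exact inv_lt_one_of_one_lt₀ ht1)
  refine ((hd t htI).sub hinv).congr_deriv ?_
  rw [log_norm_one_sub_inv (hne t ht1.le) h1s, norm_inv, Real.log_inv, Complex.sub_re,
    Complex.neg_im, Complex.neg_re, dilogExpr_ray_inv hu hslit hA₂ h₂ htI.1 htI.2]
  ring

end Ray

/-- Two functions with the same derivative on the part of a convex open set `B` inside the unit disc,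
which agree at one point there, agree on the part of `B` in the closed disc. -/
theorem eqOn_closedBall_of_hasDerivAt {f g f' : ℂ → ℂ} {B : Set ℂ} (hB : IsOpen B)
    (hBc : Convex ℝ B) {w : ℂ} (hw : w ∈ B ∩ Metric.ball 0 1)
    (hf : ∀ z ∈ B ∩ Metric.ball 0 1, HasDerivAt f (f' z) z)
    (hg : ∀ z ∈ B, HasDerivAt g (f' z) z) (hfg : f w = g w)
    (hfc : ContinuousOn f (Metric.closedBall 0 1)) :
    Set.EqOn f g (B ∩ Metric.closedBall 0 1) := by
  have hopen : IsOpen (B ∩ Metric.ball (0 : ℂ) 1) := hB.inter Metric.isOpen_ball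
  have hin : Set.EqOn f g (B ∩ Metric.ball 0 1) := by
    refine hopen.eqOn_of_deriv_eq (hBc.inter (convex_ball _ _)).isPreconnected
      (fun z hz => (hf z hz).differentiableAt.differentiableWithinAt)
      (fun z hz => (hg z hz.1).differentiableAt.differentiableWithinAt)
      (fun z hz => by rw [(hf z hz).deriv, (hg z hz.1).deriv]) hw hfg
  refine hin.of_subset_closure (hfc.mono Set.inter_subset_right)
    (fun z hz => (hg z hz.1).continuousAt.continuousWithinAt)
    (Set.inter_subset_inter_right _ Metric.ball_subset_closedBall) ?_
  rw [← closure_ball (0 : ℂ) one_ne_zero]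
  exact hB.inter_closure

/-- Across the unit circle, `svTrilog` is given by primitives on a small ball. -/
theorem analyticAt_svTrilog_of_norm_eq_one {z₀ : ℂ} (hz₀ : ‖z₀‖ = 1) (h1 : z₀ ≠ 1) :
    AnalyticAt ℝ svTrilog z₀ := by
  have hz0 : z₀ ≠ 0 := by rintro rfl; simp at hz₀
  have hV : IsOpen {z : ℂ | z ≠ 0 ∧ 1 - z ∈ Complex.slitPlane} :=
    isOpen_ne.inter (Complex.isOpen_slitPlane.preimage (by fun_prop : Continuous fun z : ℂ => 1 - z))
  obtain ⟨ρ, hρ, hB⟩ := Metric.isOpen_iff.1 hV z₀ ⟨hz0, one_sub_mem_slitPlane hz₀.le h1⟩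
  set B := Metric.ball z₀ ρ with hBdef
  have hB0 : ∀ z ∈ B, z ≠ 0 := fun z hz => (hB hz).1
  have hBs : ∀ z ∈ B, 1 - z ∈ Complex.slitPlane := fun z hz => (hB hz).2
  have hz₀B : z₀ ∈ B := Metric.mem_ball_self hρ
  obtain ⟨w, hwB, hwd⟩ : (B ∩ Metric.ball (0 : ℂ) 1).Nonempty := by
    have : z₀ ∈ closure (Metric.ball (0 : ℂ) 1) := by
      rw [closure_ball (0 : ℂ) one_ne_zero]; simp [hz₀]
    exact mem_closure_iff.1 this B Metric.isOpen_ball hz₀B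
  have hdisc : ∀ z ∈ B ∩ Metric.ball (0 : ℂ) 1, ‖z‖ < 1 := fun z hz => by simpa using hz.2
  obtain ⟨A₂, hA₂w, hA₂⟩ := Complex.IsExactOn.with_val_at (DifferentiableOn.isExactOn_ball
    (f := fun z => -Complex.log (1 - z) / z) (c := z₀) (r := ρ) fun z hz =>
      ((((differentiableAt_const _).sub differentiableAt_id).clog (hBs z hz)).neg.div
        differentiableAt_id (hB0 z hz)).differentiableWithinAt) w (polylogSeries 2 w)
  obtain ⟨A₃, hA₃w, hA₃⟩ := Complex.IsExactOn.with_val_at (DifferentiableOn.isExactOn_ball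
    (f := fun z => A₂ z / z) (c := z₀) (r := ρ) fun z hz =>
      ((hA₂ z hz).differentiableAt.div
        differentiableAt_id (hB0 z hz)).differentiableWithinAt) w (polylogSeries 3 w)
  have e₂ : Set.EqOn (polylogSeries 2) A₂ (B ∩ Metric.closedBall 0 1) :=
    eqOn_closedBall_of_hasDerivAt Metric.isOpen_ball (convex_ball _ _) ⟨hwB, hwd⟩
      (fun z hz => hasDerivAt_polylogSeries_two (hdisc z hz) (hB0 z hz.1)) hA₂ hA₂w.symm
      (continuousOn_polylogSeries le_rfl)
  have e₃ : Set.EqOn (polylogSeries 3) A₃ (B ∩ Metric.closedBall 0 1) :=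
    eqOn_closedBall_of_hasDerivAt Metric.isOpen_ball (convex_ball _ _) ⟨hwB, hwd⟩
      (fun z hz => by
        rw [← e₂ ⟨hz.1, Metric.ball_subset_closedBall hz.2⟩]
        exact hasDerivAt_polylogSeries_succ (hdisc z hz) (hB0 z hz.1) 2) hA₃ hA₃w.symm
      (continuousOn_polylogSeries (by norm_num))
  have hBnhds : B ∈ 𝓝 z₀ := Metric.isOpen_ball.mem_nhds hz₀B
  have hana : ∀ {A A' : ℂ → ℂ}, (∀ z ∈ B, HasDerivAt A (A' z) z) → AnalyticAt ℝ A z₀ :=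
    fun hA => AnalyticAt.restrictScalars (𝕜 := ℝ) (DifferentiableOn.analyticAt
      (fun z hz => (hA z hz).differentiableAt.differentiableWithinAt) hBnhds)
  have hG : AnalyticAt ℝ (fun z => trilogExpr z fun i => i.rec (A₂ z) (A₃ z)) z₀ := by
    refine analyticAt_trilogExpr analyticAt_id hz0 h1 fun i => ?_
    cases i
    · exact hana hA₂
    · exact hana hA₃
  refine hG.congr ?_
  -- the radial projection to the circle stays in the ball
  have hproj : ∀ᶠ z in 𝓝 z₀, z / (‖z‖ : ℂ) ∈ B := by
    have hc : ContinuousAt (fun z : ℂ => z / (‖z‖ : ℂ)) z₀ :=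
      continuousAt_id.div (Complex.continuous_ofReal.comp continuous_norm).continuousAt
        (by simpa using hz0)
    refine hc.eventually_mem ?_
    simpa [hz₀] using hBnhds
  filter_upwards [hBnhds, hproj] with z hz hzu
  rcases le_total ‖z‖ 1 with hn | hn
  · rw [svTrilog_of_norm_le hn, discTrilog]
    congr 1
    funext i
    have hz' : z ∈ B ∩ Metric.closedBall (0 : ℂ) 1 := ⟨hz, by simpa using hn⟩
    cases i
    · exact (e₂ hz').symm
    · exact (e₃ hz').symm
  · have hn0 : (‖z‖ : ℂ) ≠ 0 := Complex.ofReal_ne_zero.2 (by linarith)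
    set u := z / (‖z‖ : ℂ) with hu
    have hzu' : z = (‖z‖ : ℂ) * u := by rw [hu]; field_simp
    have hun : ‖u‖ = 1 := by
      rw [hu, norm_div, Complex.norm_real, norm_norm, div_self (by linarith)]
    have hub : u ∈ B ∩ Metric.closedBall (0 : ℂ) 1 := ⟨hzu, by simp [hun]⟩
    have hray : ∀ t : ℝ, t ∈ Set.Icc 1 ‖z‖ → (t : ℂ) * u ∈ B := by
      intro t ht
      let g : ℝ →ₗ[ℝ] ℂ := (LinearMap.id : ℝ →ₗ[ℝ] ℝ).smulRight u
      have hg : ∀ s, g s = (s : ℂ) * u := fun s => by simp [g]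
      have hconv : Convex ℝ (g ⁻¹' B) := (convex_ball _ _).linear_preimage g
      have h1' : (1 : ℝ) ∈ g ⁻¹' B := by rw [Set.mem_preimage, hg]; simpa using hzu
      have h2' : ‖z‖ ∈ g ⁻¹' B := by rw [Set.mem_preimage, hg, ← hzu']; exact hz
      have := hconv.ordConnected.out h1' h2' ht
      rwa [Set.mem_preimage, hg] at this
    rw [svTrilog_of_one_le_norm hn, hzu']
    have := trilogExpr_ray_inv (R := ‖z‖) hun (fun t ht => hBs _ (hray t ht))
      (fun t ht => hA₂ _ (hray t ht)) (e₂ hub).symm (fun t ht => hA₃ _ (hray t ht))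
      (e₃ hub).symm hn
    exact this

theorem analyticAt_svTrilog {z : ℂ} (h0 : z ≠ 0) (h1 : z ≠ 1) : AnalyticAt ℝ svTrilog z := by
  rcases lt_trichotomy ‖z‖ 1 with h | h | h
  · refine (analyticAt_discTrilog h h0).congr ?_
    filter_upwards [(isOpen_lt continuous_norm continuous_const).mem_nhds h] with w hw
    exact (svTrilog_of_norm_le (le_of_lt hw)).symm
  · exact analyticAt_svTrilog_of_norm_eq_one h h1
  · have hinv : ‖z⁻¹‖ < 1 := by rw [norm_inv]; exact inv_lt_one_of_one_lt₀ h
    have hi : AnalyticAt ℝ (fun w : ℂ => w⁻¹) z := analyticAt_id.inv h0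
    refine AnalyticAt.congr (AnalyticAt.comp (f := fun w : ℂ => w⁻¹) (x := z)
      (analyticAt_discTrilog hinv (inv_ne_zero h0)) hi) ?_
    filter_upwards [(isOpen_lt continuous_const continuous_norm).mem_nhds h] with w hw
    exact (svTrilog_of_one_le_norm (le_of_lt hw)).symm

/-! ### The five-term relation and the formula for `𝓛_{2,1}` -/

theorem norm_one_sub_ofReal_mul_le (z : ℂ) {t : ℝ} (h0 : 0 ≤ t) (h1 : t ≤ 1) :
    ‖1 - (t : ℂ) * z‖ ≤ (1 - t) + t * ‖1 - z‖ := by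
  have e : 1 - (t : ℂ) * z = ((1 - t : ℝ) : ℂ) + (t : ℂ) * (1 - z) := by push_cast; ring
  rw [e]
  refine (norm_add_le _ _).trans ?_
  rw [norm_mul, Complex.norm_real, Complex.norm_real, Real.norm_of_nonneg h0,
    Real.norm_of_nonneg (sub_nonneg.2 h1)]

theorem norm_one_sub_ofReal_mul_lt {z : ℂ} (hz : ‖1 - z‖ < 1) {t : ℝ} (h0 : 0 < t) (h1 : t ≤ 1) :
    ‖1 - (t : ℂ) * z‖ < 1 := by
  have := norm_one_sub_ofReal_mul_le z h0.le h1
  nlinarith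

/-- Reflection relation: both sides have opposite derivatives along the ray from `0` to `z`, and
vanish at its origin. -/
theorem discDilog_one_sub {z : ℂ} (h0 : z ≠ 0) (hz : ‖z‖ < 1) (hz1 : ‖1 - z‖ < 1) :
    discDilog (1 - z) = -discDilog z := by
  have hle : ∀ t : ℝ, t ∈ Set.Icc (0 : ℝ) 1 → ‖(t : ℂ) * z‖ ≤ t * ‖z‖ := fun t ht => by
    rw [norm_mul, Complex.norm_real, Real.norm_of_nonneg ht.1]
  have key : discDilog (1 - ((1 : ℝ) : ℂ) * z) + discDilog (((1 : ℝ) : ℂ) * z) =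
      discDilog (1 - ((0 : ℝ) : ℂ) * z) + discDilog (((0 : ℝ) : ℂ) * z) := by
    refine eq_of_hasDerivAt_zero (f := fun t : ℝ => discDilog (1 - (t : ℂ) * z) +
      discDilog ((t : ℂ) * z)) one_pos (ContinuousOn.add
        (continuousOn_discDilog.comp (by fun_prop) fun t ht => ?_)
        (continuousOn_discDilog.comp (by fun_prop) fun t ht => ?_)) fun t ht => ?_
    · rw [mem_closedBall_zero_iff]
      refine (norm_one_sub_ofReal_mul_le z ht.1 ht.2).trans ?_
      nlinarith [ht.1, ht.2]
    · have := hle t ht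
      rw [mem_closedBall_zero_iff]
      nlinarith [ht.1, ht.2, norm_nonneg z]
    · have htI : t ∈ Set.Icc (0 : ℝ) 1 := ⟨ht.1.le, ht.2.le⟩
      have ht0 : (t : ℂ) ≠ 0 := Complex.ofReal_ne_zero.2 ht.1.ne'
      have h1 : ‖(t : ℂ) * z‖ < 1 := by nlinarith [hle t htI, ht.1, ht.2, norm_nonneg z]
      have h2 : ‖1 - (t : ℂ) * z‖ < 1 := norm_one_sub_ofReal_mul_lt hz1 ht.1 ht.2.le
      have hne := sub_ne_zero.2 (ne_one_of_norm_lt h1).symm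
      have hd := hasDerivAt_ofReal_mul z ht.1
      set b : ℂ := -((t : ℂ)⁻¹ * ((t : ℂ) * z)) / (1 - (t : ℂ) * z) with hb
      have hbe : -((t : ℂ)⁻¹ * ((t : ℂ) * z)) = b * (1 - (t : ℂ) * z) := by
        rw [hb, div_mul_cancel₀ _ hne]
      have d1 := hasDerivAt_discDilog hd hbe (mul_ne_zero ht0 h0) h1
      have d2 := hasDerivAt_discDilog (c := fun s : ℝ => 1 - (s : ℂ) * z) (a := b) (b := (t : ℂ)⁻¹)
        ((hd.const_sub 1).congr_deriv hbe) (by rw [← hbe]; ring) hne h2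
      refine (d2.add d1).congr_deriv ?_
      rw [sub_sub_cancel]
      ring
  simpa [discDilog_one, discDilog_zero, add_eq_zero_iff_eq_neg] using key

/-- A region of `(x, y)` on which the arguments `x`, `y`, `x * y`, `1 - x`, `1 - x * y`,
`(1 - x) / (1 - x * y)` and `(y - x * y) / (1 - x * y)` of the functional equations all lie in the
punctured open unit disc. It is stable under `x ↦ t * x` for `0 < t ≤ 1`. -/
def fiveTermRegion : Set (ℂ × ℂ) :=
  {p | p.1 ≠ 0 ∧ p.2 ≠ 0 ∧ ‖p.1‖ < 1 ∧ ‖p.2‖ < 1 ∧ ‖1 - p.1‖ < 1 ∧ ‖1 - p.1 * p.2‖ < 1 ∧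
    ‖1 - p.1‖ < ‖1 - p.1 * p.2‖}

theorem fiveTermRegion_ofReal_mul {x y : ℂ} (h : (x, y) ∈ fiveTermRegion) {t : ℝ} (h0 : 0 < t)
    (h1 : t ≤ 1) : ((t : ℂ) * x, y) ∈ fiveTermRegion := by
  obtain ⟨hx0, hy0, hx, hy, h1x, h1xy, hlt⟩ := h
  refine ⟨mul_ne_zero (Complex.ofReal_ne_zero.2 h0.ne') hx0, hy0, ?_, hy,
    norm_one_sub_ofReal_mul_lt h1x h0 h1, ?_, ?_⟩
  · rw [norm_mul, Complex.norm_real, Real.norm_of_nonneg h0.le]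
    have : ‖x‖ < 1 := hx
    nlinarith [norm_nonneg x]
  · simp only [mul_assoc]
    exact norm_one_sub_ofReal_mul_lt h1xy h0 h1
  · -- `‖1 - t x‖² - ‖1 - t x y‖² ≤ t (‖1 - x‖² - ‖1 - x y‖²)` because `t² ≤ t`
    have hsq : ∀ (s : ℝ) (z : ℂ), ‖1 - (s : ℂ) * z‖ ^ 2 = 1 - 2 * s * z.re + s ^ 2 * ‖z‖ ^ 2 := by
      intro s z
      rw [← Complex.normSq_eq_norm_sq, ← Complex.normSq_eq_norm_sq, Complex.normSq_apply,
        Complex.normSq_apply]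
      simp
      ring
    have a1 := hsq 1 x
    have a2 := hsq 1 (x * y)
    have a3 := hsq t x
    have a4 := hsq t (x * y)
    simp only [Complex.ofReal_one, one_mul] at a1 a2
    have hlt2 : ‖1 - x‖ ^ 2 < ‖1 - x * y‖ ^ 2 := by
      have := hlt
      gcongr
    have hxy : ‖x * y‖ ^ 2 ≤ ‖x‖ ^ 2 := by
      rw [norm_mul]
      have : ‖x‖ * ‖y‖ ≤ ‖x‖ := mul_le_of_le_one_right (norm_nonneg x) (le_of_lt hy)
      gcongr
    simp only [mul_assoc]
    refine lt_of_pow_lt_pow_left₀ 2 (norm_nonneg _) ?_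
    rw [a3, a4]
    rw [a1, a2] at hlt2
    nlinarith [mul_nonneg (mul_nonneg h0.le (sub_nonneg.2 h1)) (sub_nonneg.2 hxy)]

section Region

variable {x y : ℂ}

theorem one_sub_mul_ne_zero (hx : ‖x‖ < 1) (hy : ‖y‖ < 1) : 1 - x * y ≠ 0 :=
  sub_ne_zero.2 (ne_one_of_norm_lt (norm_mul_lt_one_of_lt hx hy)).symm

theorem fiveTermRegion_norm_div_lt (h : (x, y) ∈ fiveTermRegion) :
    ‖(1 - x) / (1 - x * y)‖ < 1 ∧ ‖(y - x * y) / (1 - x * y)‖ < 1 := by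
  obtain ⟨hx0, hy0, hx, hy, h1x, h1xy, hlt⟩ := h
  have hpos : 0 < ‖1 - x * y‖ := norm_pos_iff.2 (one_sub_mul_ne_zero hx hy)
  have h1 : ‖(1 - x) / (1 - x * y)‖ < 1 := by
    rw [norm_div, div_lt_one hpos]; exact hlt
  refine ⟨h1, ?_⟩
  have e : (y - x * y) / (1 - x * y) = y * ((1 - x) / (1 - x * y)) := by ring
  rw [e]
  exact norm_mul_lt_one_of_lt hy h1

/-- All arguments of the functional equations stay in the closed unit disc along the ray from
`(0, y)` to `(x, y)`, including the initial point `(0, y)`. -/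
theorem fiveTermRegion_ray (h : (x, y) ∈ fiveTermRegion) {t : ℝ} (ht : t ∈ Set.Icc (0 : ℝ) 1) :
    ‖(t : ℂ) * x‖ < 1 ∧ ‖(t : ℂ) * x * y‖ < 1 ∧ ‖1 - (t : ℂ) * x‖ ≤ 1 ∧ ‖1 - (t : ℂ) * x * y‖ ≤ 1 ∧
      ‖(1 - (t : ℂ) * x) / (1 - (t : ℂ) * x * y)‖ ≤ 1 ∧
      ‖(y - (t : ℂ) * x * y) / (1 - (t : ℂ) * x * y)‖ ≤ 1 := by
  have hy : ‖y‖ < 1 := h.2.2.2.1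
  rcases ht.1.eq_or_lt with rfl | h0
  · simpa using hy.le
  · have h' := fiveTermRegion_ofReal_mul h h0 ht.2
    obtain ⟨h1, h2⟩ := fiveTermRegion_norm_div_lt h'
    obtain ⟨-, -, hx, hy, h1x, h1xy, -⟩ := h'
    exact ⟨hx, norm_mul_lt_one_of_lt hx hy, le_of_lt h1x, le_of_lt h1xy, h1.le, h2.le⟩

theorem continuousOn_ray_div (h : (x, y) ∈ fiveTermRegion) (w : ℂ) :
    ContinuousOn (fun t : ℝ => (w - (t : ℂ) * x * w) / (1 - (t : ℂ) * x * y))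
      (Set.Icc (0 : ℝ) 1) :=
  ContinuousOn.div (by fun_prop) (by fun_prop) fun t ht =>
    sub_ne_zero.2 (ne_one_of_norm_lt (fiveTermRegion_ray h ht).2.1).symm

/-- The logarithmic derivatives of `1 - x`, `1 - x * y`, `(1 - x) / (1 - x * y)` and
`(y - x * y) / (1 - x * y)` along the ray `t ↦ (t * x, y)`, where `b` and `c` are those
of `1 - x` and `1 - x * y`. -/
theorem hasDerivAt_ray {t : ℝ} (ht : 0 < t) (h1 : 1 - (t : ℂ) * x ≠ 0)
    (h2 : 1 - (t : ℂ) * x * y ≠ 0) {b c : ℂ}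
    (hb : -((t : ℂ)⁻¹ * ((t : ℂ) * x)) = b * (1 - (t : ℂ) * x))
    (hc : -((t : ℂ)⁻¹ * ((t : ℂ) * x * y)) = c * (1 - (t : ℂ) * x * y)) :
    HasDerivAt (fun s : ℝ => (s : ℂ) * x * y) ((t : ℂ)⁻¹ * ((t : ℂ) * x * y)) t ∧
    HasDerivAt (fun s : ℝ => 1 - (s : ℂ) * x) (b * (1 - (t : ℂ) * x)) t ∧
    HasDerivAt (fun s : ℝ => 1 - (s : ℂ) * x * y) (c * (1 - (t : ℂ) * x * y)) t ∧
    ∀ w : ℂ, HasDerivAt (fun s : ℝ => (w - (s : ℂ) * x * w) / (1 - (s : ℂ) * x * y))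
      ((b - c) * ((w - (t : ℂ) * x * w) / (1 - (t : ℂ) * x * y))) t := by
  have hd := hasDerivAt_ofReal_mul x ht
  have d2 : HasDerivAt (fun s : ℝ => (s : ℂ) * x * y) ((t : ℂ)⁻¹ * ((t : ℂ) * x * y)) t :=
    (hd.mul_const y).congr_deriv (by ring)
  have d3 := (hd.const_sub 1).congr_deriv hb
  have d4 := (d2.const_sub 1).congr_deriv hc
  refine ⟨d2, d3, d4, fun w => ?_⟩
  have d5 := ((hd.mul_const w).const_sub w).div d4 h2
  refine d5.congr_deriv ?_
  have hw : -((t : ℂ)⁻¹ * ((t : ℂ) * x) * w) = b * (w - (t : ℂ) * x * w) := by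
    linear_combination w * hb
  rw [hw]
  field_simp

theorem log_norm_fiveTerm (hx : ‖x‖ < 1) (hy : ‖y‖ < 1) (hx0 : x ≠ 0) (hy0 : y ≠ 0) :
    Real.log ‖x * y‖ = Real.log ‖x‖ + Real.log ‖y‖ ∧
    Real.log ‖(1 - x) / (1 - x * y)‖ = Real.log ‖1 - x‖ - Real.log ‖1 - x * y‖ ∧
    Real.log ‖1 - (1 - x) / (1 - x * y)‖ =
      Real.log ‖x‖ + Real.log ‖1 - y‖ - Real.log ‖1 - x * y‖ ∧
    Real.log ‖(y - x * y) / (1 - x * y)‖ =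
      Real.log ‖y‖ + Real.log ‖1 - x‖ - Real.log ‖1 - x * y‖ ∧
    Real.log ‖1 - (y - x * y) / (1 - x * y)‖ = Real.log ‖1 - y‖ - Real.log ‖1 - x * y‖ := by
  have h1x : 1 - x ≠ 0 := sub_ne_zero.2 (ne_one_of_norm_lt hx).symm
  have h1y : 1 - y ≠ 0 := sub_ne_zero.2 (ne_one_of_norm_lt hy).symm
  have hxy := one_sub_mul_ne_zero hx hy
  have n : ∀ {z : ℂ}, z ≠ 0 → ‖z‖ ≠ 0 := norm_ne_zero_iff.2
  have e1 : 1 - (1 - x) / (1 - x * y) = x * (1 - y) / (1 - x * y) := by field_simp; ring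
  have e2 : y - x * y = y * (1 - x) := by ring
  have e3 : 1 - (y - x * y) / (1 - x * y) = (1 - y) / (1 - x * y) := by
    rw [eq_div_iff hxy, sub_mul, div_mul_cancel₀ _ hxy]; ring
  refine ⟨?_, ?_, ?_, ?_, ?_⟩
  · rw [norm_mul, Real.log_mul (n hx0) (n hy0)]
  · rw [norm_div, Real.log_div (n h1x) (n hxy)]
  · rw [e1, norm_div, Real.log_div (n (mul_ne_zero hx0 h1y)) (n hxy), norm_mul,
      Real.log_mul (n hx0) (n h1y)]
  · rw [e2, norm_div, Real.log_div (n (mul_ne_zero hy0 h1x)) (n hxy), norm_mul,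
      Real.log_mul (n hy0) (n h1x)]
  · rw [e3, norm_div, Real.log_div (n h1y) (n hxy)]

/-- The five-term relation: the derivative along the ray from `(0, y)` to `(x, y)` vanishes, and so
does the sum at the initial point. -/
theorem discDilog_fiveTerm (h : (x, y) ∈ fiveTermRegion) :
    discDilog x + discDilog y - discDilog (x * y) + discDilog ((1 - x) / (1 - x * y))
      - discDilog ((y - x * y) / (1 - x * y)) = 0 := by
  let f : ℝ → ℝ := fun t => discDilog ((t : ℂ) * x) + discDilog y - discDilog ((t : ℂ) * x * y)
    + discDilog ((1 - (t : ℂ) * x) / (1 - (t : ℂ) * x * y))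
    - discDilog ((y - (t : ℂ) * x * y) / (1 - (t : ℂ) * x * y))
  suffices f 1 = f 0 by simpa [f, discDilog_zero, discDilog_one] using this
  have hmem : ∀ {z : ℂ}, ‖z‖ ≤ 1 → z ∈ Metric.closedBall (0 : ℂ) 1 := fun hz => by simpa using hz
  have hcont1 : ContinuousOn (fun t : ℝ => (1 - (t : ℂ) * x) / (1 - (t : ℂ) * x * y))
      (Set.Icc (0 : ℝ) 1) := by simpa only [mul_one] using continuousOn_ray_div h 1
  refine eq_of_hasDerivAt_zero one_pos ((((ContinuousOn.add
    (continuousOn_discDilog.comp (by fun_prop) fun t ht => hmem (fiveTermRegion_ray h ht).1.le)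
    continuousOn_const).sub
    (continuousOn_discDilog.comp (by fun_prop) fun t ht => hmem (fiveTermRegion_ray h ht).2.1.le)).add
    (continuousOn_discDilog.comp hcont1 fun t ht => hmem (fiveTermRegion_ray h ht).2.2.2.2.1)).sub
    (continuousOn_discDilog.comp (continuousOn_ray_div h y)
      fun t ht => hmem (fiveTermRegion_ray h ht).2.2.2.2.2)) fun t ht => ?_
  have h' := fiveTermRegion_ofReal_mul h ht.1 ht.2.le
  have hlt := fiveTermRegion_norm_div_lt h'
  obtain ⟨hX0, hy0, hX, hy, -, -, -⟩ := h'
  have hXY := norm_mul_lt_one_of_lt hX hy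
  have h1 : 1 - (t : ℂ) * x ≠ 0 := sub_ne_zero.2 (ne_one_of_norm_lt hX).symm
  have h2 : 1 - (t : ℂ) * x * y ≠ 0 := one_sub_mul_ne_zero hX hy
  have h1y : 1 - y ≠ 0 := sub_ne_zero.2 (ne_one_of_norm_lt hy).symm
  obtain ⟨l1, l2, l3, l4, l5⟩ := log_norm_fiveTerm hX hy hX0 hy0
  set b : ℂ := -((t : ℂ)⁻¹ * ((t : ℂ) * x)) / (1 - (t : ℂ) * x) with hbdef
  set c : ℂ := -((t : ℂ)⁻¹ * ((t : ℂ) * x * y)) / (1 - (t : ℂ) * x * y) with hcdef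
  have hb : -((t : ℂ)⁻¹ * ((t : ℂ) * x)) = b * (1 - (t : ℂ) * x) := by
    rw [hbdef, div_mul_cancel₀ _ h1]
  have hc : -((t : ℂ)⁻¹ * ((t : ℂ) * x * y)) = c * (1 - (t : ℂ) * x * y) := by
    rw [hcdef, div_mul_cancel₀ _ h2]
  obtain ⟨d2, d3, d4, d5⟩ := hasDerivAt_ray ht.1 h1 h2 hb hc
  have ht0 : (t : ℂ) ≠ 0 := Complex.ofReal_ne_zero.2 ht.1.ne'
  have D1 := hasDerivAt_discDilog (hasDerivAt_ofReal_mul x ht.1) hb hX0 hX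
  have D2 := hasDerivAt_discDilog d2 hc (mul_ne_zero hX0 hy0) hXY
  have D5 := hasDerivAt_discDilog (c := fun s : ℝ => (1 - (s : ℂ) * x) / (1 - (s : ℂ) * x * y))
    (a := b - c) (b := (t : ℂ)⁻¹ - c) (by simpa only [mul_one] using d5 1)
    (by rw [hbdef, hcdef]; field_simp; ring) (div_ne_zero h1 h2) hlt.1
  have D6 := hasDerivAt_discDilog (c := fun s : ℝ => (y - (s : ℂ) * x * y) / (1 - (s : ℂ) * x * y))
    (a := b - c) (b := -c) (d5 y)
    (by rw [hbdef, hcdef]; field_simp; ring)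
    (div_ne_zero (by rw [← one_sub_mul]; exact mul_ne_zero h1 hy0) h2) hlt.2
  refine ((((D1.add_const (discDilog y)).sub D2).add D5).sub D6).congr_deriv ?_
  rw [l1, l2, l3, l4, l5]
  simp only [Complex.sub_im, Complex.neg_im]
  ring

end Region

/-- The formula for `𝓛_{2,1}(y, x)` on the polydisc, with the logarithms of products and quotients
expanded. In this form it vanishes, and is continuous, at `x = 0`. -/
def polydiscLi21 (x y : ℂ) : ℝ :=
  (doublePolylogSeries 2 1 y x).re
    + (Complex.log (1 - x * y)).im * (discDilog y + discDilog x)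
    - (Complex.log (1 - x)).im * discDilog y
    + Real.log ‖1 - x‖ * (polylogSeries 2 (x * y)).re
    - Real.log ‖y‖ * (doublePolylogSeries 1 1 y x).re
    + 1 / 3 * ((Real.log ‖1 - x‖ * Real.log ‖x‖ + Real.log ‖1 - x‖ * Real.log ‖y‖)
        * Real.log ‖1 - x * y‖)
    + 1 / 3 * Real.log ‖y‖ * (Real.log ‖1 - x‖ * Real.log ‖1 - y‖
        + Real.log ‖1 - x * y‖ * (Real.log ‖y‖ + Real.log ‖1 - x‖ - Real.log ‖1 - y‖))

theorem expr21_eq_polydiscLi21 {x y : ℂ} (hx0 : x ≠ 0) (hy0 : y ≠ 0) (hx : ‖x‖ < 1)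
    (hy : ‖y‖ < 1) : expr21 (y, x) (fun i => doubleStart i (y, x)) = polydiscLi21 x y := by
  have n : ∀ {z : ℂ}, z ≠ 0 → ‖z‖ ≠ 0 := norm_ne_zero_iff.2
  have h1x : 1 - x ≠ 0 := sub_ne_zero.2 (ne_one_of_norm_lt hx).symm
  have h1y : 1 - y ≠ 0 := sub_ne_zero.2 (ne_one_of_norm_lt hy).symm
  simp only [expr21, doubleStart, polydiscLi21, discDilog, mul_comm y x]
  rw [norm_mul x y, Real.log_mul (n hx0) (n hy0), norm_div, norm_mul,
    Real.log_div (mul_ne_zero (n hy0) (n h1x)) (n h1y), Real.log_mul (n hy0) (n h1x)]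
  ring

theorem continuousAt_log_norm_one_sub_mul_log_norm {z : ℂ} (h1 : z ≠ 1) :
    ContinuousAt (fun z : ℂ => Real.log ‖1 - z‖ * Real.log ‖z‖) z := by
  by_cases h0 : z = 0
  · subst h0
    have := tendsto_log_norm_pow_mul (isBigO_re isBigO_clog_one_sub) (Or.inl rfl)
    simpa [ContinuousAt, Complex.log_re, mul_comm] using this
  · exact ((continuousAt_const.sub continuousAt_id).norm.log
        (norm_ne_zero_iff.2 (sub_ne_zero.2 (Ne.symm h1)))).mul (continuousAt_log_norm h0)

theorem doublePolylogSeries_zero_right (m n : ℕ) (x : ℂ) : doublePolylogSeries m n x 0 = 0 := by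
  rw [doublePolylogSeries]
  refine (tsum_congr fun k => ?_).trans tsum_zero
  have : k.1.2 ≠ 0 := by have := k.2; omega
  simp [this]

theorem polydiscLi21_zero_left (y : ℂ) : polydiscLi21 0 y = 0 := by
  simp [polydiscLi21, doublePolylogSeries_zero_right]

section Ray

variable {x y : ℂ}

theorem continuousOn_polydiscLi21_ray (hx : ‖x‖ < 1) (hy : ‖y‖ < 1) :
    ContinuousOn (fun t : ℝ => polydiscLi21 ((t : ℂ) * x) y) (Set.Icc (0 : ℝ) 1) := by
  have hX : ∀ t ∈ Set.Icc (0 : ℝ) 1, ‖(t : ℂ) * x‖ < 1 := fun t ht => by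
    rw [norm_mul, Complex.norm_real, Real.norm_of_nonneg ht.1]
    nlinarith [ht.1, ht.2, norm_nonneg x]
  have hXY : ∀ t ∈ Set.Icc (0 : ℝ) 1, ‖(t : ℂ) * x * y‖ < 1 := fun t ht =>
    norm_mul_lt_one_of_lt (hX t ht) hy
  have cX : ContinuousOn (fun t : ℝ => (t : ℂ) * x) (Set.Icc (0 : ℝ) 1) := by fun_prop
  have cXY : ContinuousOn (fun t : ℝ => (t : ℂ) * x * y) (Set.Icc (0 : ℝ) 1) := by fun_prop
  have hball : ∀ {z : ℂ}, ‖z‖ < 1 → z ∈ Metric.closedBall (0 : ℂ) 1 := fun hz => by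
    simpa using hz.le
  have re := fun {f : ℝ → ℂ} (h : ContinuousOn f (Set.Icc (0 : ℝ) 1)) =>
    Complex.continuous_re.comp_continuousOn h
  have im := fun {f : ℝ → ℂ} (h : ContinuousOn f (Set.Icc (0 : ℝ) 1)) =>
    Complex.continuous_im.comp_continuousOn h
  have dp : ∀ m : ℕ, m ≠ 0 → ContinuousOn (fun t : ℝ => doublePolylogSeries m 1 y ((t : ℂ) * x))
      (Set.Icc (0 : ℝ) 1) := fun m hm t ht =>
    ContinuousAt.comp_continuousWithinAt (f := fun t : ℝ => (t : ℂ) * x)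
      (hasDerivAt_doublePolylogSeries hy (hX t ht) hm).continuousAt (cX t ht)
  have lX : ContinuousOn (fun t : ℝ => Complex.log (1 - (t : ℂ) * x)) (Set.Icc (0 : ℝ) 1) :=
    (continuousOn_const.sub cX).clog fun t ht =>
      one_sub_mem_slitPlane (hX t ht).le (ne_one_of_norm_lt (hX t ht))
  have lXY : ContinuousOn (fun t : ℝ => Complex.log (1 - (t : ℂ) * x * y)) (Set.Icc (0 : ℝ) 1) :=
    (continuousOn_const.sub cXY).clog fun t ht =>
      one_sub_mem_slitPlane (hXY t ht).le (ne_one_of_norm_lt (hXY t ht))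
  have rX : ContinuousOn (fun t : ℝ => Real.log ‖1 - (t : ℂ) * x‖) (Set.Icc (0 : ℝ) 1) := by
    simpa only [← Complex.log_re, Function.comp_def] using re lX
  have rXY : ContinuousOn (fun t : ℝ => Real.log ‖1 - (t : ℂ) * x * y‖) (Set.Icc (0 : ℝ) 1) := by
    simpa only [← Complex.log_re, Function.comp_def] using re lXY
  have DX : ContinuousOn (fun t : ℝ => discDilog ((t : ℂ) * x)) (Set.Icc (0 : ℝ) 1) :=
    continuousOn_discDilog.comp cX fun t ht => hball (hX t ht)
  have pXY : ContinuousOn (fun t : ℝ => polylogSeries 2 ((t : ℂ) * x * y)) (Set.Icc (0 : ℝ) 1) :=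
    (continuousOn_polylogSeries le_rfl).comp cXY fun t ht => hball (hXY t ht)
  have prod : ContinuousOn (fun t : ℝ => Real.log ‖1 - (t : ℂ) * x‖ * Real.log ‖(t : ℂ) * x‖)
      (Set.Icc (0 : ℝ) 1) := fun t ht =>
    ContinuousAt.comp_continuousWithinAt (f := fun t : ℝ => (t : ℂ) * x)
      (continuousAt_log_norm_one_sub_mul_log_norm (ne_one_of_norm_lt (hX t ht))) (cX t ht)
  unfold polydiscLi21
  exact ((((((re (dp 2 two_ne_zero)).add ((im lXY).mul (continuousOn_const.add DX))).sub
    ((im lX).mul continuousOn_const)).add (rX.mul (re pXY))).sub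
    (continuousOn_const.mul (re (dp 1 one_ne_zero)))).add
    (continuousOn_const.mul ((prod.add (rX.mul continuousOn_const)).mul rXY))).add
    (continuousOn_const.mul ((rX.mul continuousOn_const).add
      (rXY.mul ((continuousOn_const.add rX).sub continuousOn_const))))

/-- Along the ray `t ↦ (t * x, y)`, with logarithmic derivatives `t⁻¹`, `b`, `c` of `x`, `1 - x`,
`1 - x * y`, only single-valued functions occur in the differential of `𝓛_{2,1}(y, x)`. -/
theorem hasDerivAt_polydiscLi21_ray {t : ℝ} (ht : 0 < t) (hX0 : (t : ℂ) * x ≠ 0)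
    (hX : ‖(t : ℂ) * x‖ < 1) (hy0 : y ≠ 0) (hy : ‖y‖ < 1) {b c : ℂ}
    (hb : -((t : ℂ)⁻¹ * ((t : ℂ) * x)) = b * (1 - (t : ℂ) * x))
    (hc : -((t : ℂ)⁻¹ * ((t : ℂ) * x * y)) = c * (1 - (t : ℂ) * x * y)) :
    HasDerivAt (fun s : ℝ => polydiscLi21 ((s : ℂ) * x) y)
      (b.im * (discDilog ((t : ℂ) * x * y) - discDilog y)
        + c.im * (discDilog ((t : ℂ) * x) + discDilog y)
        - Real.log ‖1 - (t : ℂ) * x‖ * Real.log ‖1 - (t : ℂ) * x * y‖ * ((t : ℂ)⁻¹).re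
        - Real.log ‖y‖ * Real.log ‖1 - (t : ℂ) * x * y‖ * b.re
        + 1 / 3 * ((b.re * (Real.log ‖(t : ℂ) * x‖ + Real.log ‖y‖)
          + Real.log ‖1 - (t : ℂ) * x‖ * ((t : ℂ)⁻¹).re) * Real.log ‖1 - (t : ℂ) * x * y‖
          + Real.log ‖1 - (t : ℂ) * x‖ * (Real.log ‖(t : ℂ) * x‖ + Real.log ‖y‖) * c.re)
        + 1 / 3 * Real.log ‖y‖ * (b.re * Real.log ‖1 - y‖
          + c.re * (Real.log ‖y‖ + Real.log ‖1 - (t : ℂ) * x‖ - Real.log ‖1 - y‖)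
          + Real.log ‖1 - (t : ℂ) * x * y‖ * b.re)) t := by
  have hXY := norm_mul_lt_one_of_lt hX hy
  have s1 := one_sub_mem_slitPlane hX.le (ne_one_of_norm_lt hX)
  have s2 := one_sub_mem_slitPlane hXY.le (ne_one_of_norm_lt hXY)
  have h1 := Complex.slitPlane_ne_zero s1
  have h2 := Complex.slitPlane_ne_zero s2
  have d1 := hasDerivAt_ofReal_mul x ht
  obtain ⟨d2, d3, d4, -⟩ := hasDerivAt_ray ht h1 h2 hb hc
  have uX := hasDerivAt_log_norm d1 hX0
  have rX := hasDerivAt_log_norm d3 h1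
  have rXY := hasDerivAt_log_norm d4 h2
  have lX : HasDerivAt (fun s : ℝ => Complex.log (1 - (s : ℂ) * x)) b t := by
    simpa [h1] using d3.clog_real s1
  have lXY : HasDerivAt (fun s : ℝ => Complex.log (1 - (s : ℂ) * x * y)) c t := by
    simpa [h2] using d4.clog_real s2
  have DX := hasDerivAt_discDilog d1 hb hX0 hX
  have pXY := (hasDerivAt_polylogSeries_two hXY (mul_ne_zero hX0 hy0)).comp t d2
  have dp := fun (m : ℕ) (hm : m ≠ 0) => (hasDerivAt_doublePolylogSeries hy hX hm).comp t d1
  have e1 : ∀ w : ℂ, w / (1 - (t : ℂ) * x) * ((t : ℂ)⁻¹ * ((t : ℂ) * x)) = -(w * b) := by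
    intro w
    rw [div_mul_eq_mul_div, div_eq_iff h1]
    linear_combination -w * hb
  have e2 : -Complex.log (1 - (t : ℂ) * x * y) / ((t : ℂ) * x * y) *
      ((t : ℂ)⁻¹ * ((t : ℂ) * x * y)) = -(Complex.log (1 - (t : ℂ) * x * y) * (t : ℂ)⁻¹) := by
    rw [div_mul_eq_mul_div, div_eq_iff (mul_ne_zero hX0 hy0)]
    ring
  have key := ((((((dp 2 two_ne_zero).complex_re.add
    (lXY.complex_im.mul (DX.const_add (discDilog y)))).sub
    (lX.complex_im.mul_const (discDilog y))).add (rX.mul pXY.complex_re)).sub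
    ((dp 1 one_ne_zero).complex_re.const_mul (Real.log ‖y‖))).add
    ((((rX.mul uX).add (rX.mul_const (Real.log ‖y‖))).mul rXY).const_mul (1 / 3))).add
    (((rX.mul_const (Real.log ‖1 - y‖)).add (rXY.mul
      ((rX.const_add (Real.log ‖y‖)).sub_const (Real.log ‖1 - y‖)))).const_mul
        (1 / 3 * Real.log ‖y‖))
  refine key.congr_deriv ?_
  have hD : discDilog ((t : ℂ) * x * y) = (polylogSeries 2 ((t : ℂ) * x * y)).im +
      (Complex.log (1 - (t : ℂ) * x * y)).im * (Real.log ‖(t : ℂ) * x‖ + Real.log ‖y‖) := by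
    rw [discDilog, dilogExpr, norm_mul ((t : ℂ) * x) y,
      Real.log_mul (norm_ne_zero_iff.2 hX0) (norm_ne_zero_iff.2 hy0)]
  rw [e1, e1, e2, hD, mul_comm y ((t : ℂ) * x), polylogSeries_one hXY]
  simp only [Function.comp_apply, Pi.add_apply, Pi.mul_apply, Complex.neg_re, Complex.mul_re, Complex.neg_im,
    Complex.log_re]
  ring

/-- Along the ray from `(0, y)` to `(x, y)` the difference of both sides has derivative zero, by the
reflection and five-term relations of the dilogarithm, and it vanishes at the initial point. -/
theorem polydiscLi21_eq_discTrilog (h : (x, y) ∈ fiveTermRegion) :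
    polydiscLi21 x y = discTrilog (1 - x * y) + discTrilog (1 - x)
      - discTrilog ((1 - x) / (1 - x * y)) - discTrilog y
      + discTrilog ((y - x * y) / (1 - x * y)) - discTrilog 1 := by
  let f : ℝ → ℝ := fun t => polydiscLi21 ((t : ℂ) * x) y
    - (discTrilog (1 - (t : ℂ) * x * y) + discTrilog (1 - (t : ℂ) * x)
      - discTrilog ((1 - (t : ℂ) * x) / (1 - (t : ℂ) * x * y)) - discTrilog y
      + discTrilog ((y - (t : ℂ) * x * y) / (1 - (t : ℂ) * x * y)) - discTrilog 1)
  suffices f 1 = f 0 by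
    refine sub_eq_zero.1 ?_
    simpa [f, polydiscLi21_zero_left] using this
  have hmem : ∀ {z : ℂ}, ‖z‖ ≤ 1 → z ∈ Metric.closedBall (0 : ℂ) 1 := fun hz => by simpa using hz
  have hcont1 : ContinuousOn (fun t : ℝ => (1 - (t : ℂ) * x) / (1 - (t : ℂ) * x * y))
      (Set.Icc (0 : ℝ) 1) := by simpa only [mul_one] using continuousOn_ray_div h 1
  refine eq_of_hasDerivAt_zero one_pos ((continuousOn_polydiscLi21_ray h.2.2.1 h.2.2.2.1).sub
    (((((ContinuousOn.add
    (continuousOn_discTrilog.comp (by fun_prop) fun t ht =>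
      hmem (fiveTermRegion_ray h ht).2.2.2.1)
    (continuousOn_discTrilog.comp (by fun_prop) fun t ht =>
      hmem (fiveTermRegion_ray h ht).2.2.1)).sub
    (continuousOn_discTrilog.comp hcont1 fun t ht =>
      hmem (fiveTermRegion_ray h ht).2.2.2.2.1)).sub continuousOn_const).add
    (continuousOn_discTrilog.comp (continuousOn_ray_div h y)
      fun t ht => hmem (fiveTermRegion_ray h ht).2.2.2.2.2)).sub continuousOn_const))
    fun t ht => ?_
  have h' := fiveTermRegion_ofReal_mul h ht.1 ht.2.le
  have hlt := fiveTermRegion_norm_div_lt h'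
  have h5 := discDilog_fiveTerm h'
  obtain ⟨hX0, hy0, hX, hy, h1X, h1XY, -⟩ := h'
  have hXY := norm_mul_lt_one_of_lt hX hy
  have r1 := discDilog_one_sub hX0 hX h1X
  have r2 := discDilog_one_sub (mul_ne_zero hX0 hy0) hXY h1XY
  have h1 : 1 - (t : ℂ) * x ≠ 0 := sub_ne_zero.2 (ne_one_of_norm_lt hX).symm
  have h2 : 1 - (t : ℂ) * x * y ≠ 0 := one_sub_mul_ne_zero hX hy
  obtain ⟨l1, l2, l3, l4, l5⟩ := log_norm_fiveTerm hX hy hX0 hy0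
  set b : ℂ := -((t : ℂ)⁻¹ * ((t : ℂ) * x)) / (1 - (t : ℂ) * x) with hbdef
  set c : ℂ := -((t : ℂ)⁻¹ * ((t : ℂ) * x * y)) / (1 - (t : ℂ) * x * y) with hcdef
  have hb : -((t : ℂ)⁻¹ * ((t : ℂ) * x)) = b * (1 - (t : ℂ) * x) := by
    rw [hbdef, div_mul_cancel₀ _ h1]
  have hc : -((t : ℂ)⁻¹ * ((t : ℂ) * x * y)) = c * (1 - (t : ℂ) * x * y) := by
    rw [hcdef, div_mul_cancel₀ _ h2]
  obtain ⟨d2, d3, d4, d5⟩ := hasDerivAt_ray ht.1 h1 h2 hb hc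
  have ht0 : (t : ℂ) ≠ 0 := Complex.ofReal_ne_zero.2 ht.1.ne'
  have L := hasDerivAt_polydiscLi21_ray ht.1 hX0 hX hy0 hy hb hc
  have T3 := hasDerivAt_discTrilog (c := fun s : ℝ => 1 - (s : ℂ) * x) (b := (t : ℂ)⁻¹) d3
    (by rw [← hb]; ring) h1 h1X
  have T4 := hasDerivAt_discTrilog (c := fun s : ℝ => 1 - (s : ℂ) * x * y) (b := (t : ℂ)⁻¹) d4
    (by rw [← hc]; ring) h2 h1XY
  have T5 := hasDerivAt_discTrilog (c := fun s : ℝ => (1 - (s : ℂ) * x) / (1 - (s : ℂ) * x * y))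
    (a := b - c) (b := (t : ℂ)⁻¹ - c) (by simpa only [mul_one] using d5 1)
    (by rw [hbdef, hcdef]; field_simp; ring) (div_ne_zero h1 h2) hlt.1
  have T6 := hasDerivAt_discTrilog (c := fun s : ℝ => (y - (s : ℂ) * x * y) / (1 - (s : ℂ) * x * y))
    (a := b - c) (b := -c) (d5 y)
    (by rw [hbdef, hcdef]; field_simp; ring)
    (div_ne_zero (by rw [← one_sub_mul]; exact mul_ne_zero h1 hy0) h2) hlt.2
  refine (L.sub (((((T4.add T3).sub T5).sub_const (discTrilog y)).add T6).sub_const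
    (discTrilog 1))).congr_deriv ?_
  rw [l2, l3, l4, l5, sub_sub_cancel, sub_sub_cancel, r1, r2, l1]
  simp only [Complex.sub_im, Complex.sub_re, Complex.neg_re]
  linear_combination (c.im - b.im) * h5

end Ray

/-! ### The single-valued double polylogarithms on `S₂` -/

theorem isSingleValuedTrilog_svTrilog : IsSingleValuedTrilog svTrilog := by
  refine ⟨isSingleValued_of_eqOn (isOpen_lt continuous_norm continuous_const)
    (isOpen_ne.inter isOpen_ne) (fun p hp g hg => ?_) (fun z hz => analyticAt_svTrilog hz.1 hz.2)
    (fun z _ hz => svTrilog_of_norm_le (le_of_lt hz)), continuous_svTrilog⟩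
  exact analyticAt_trilogExpr analyticAt_id hp.1 hp.2 fun i => (hg i).restrictScalars

theorem analyticAt_doubleStart {p : ℂ × ℂ} (hp : p ∈ polydisc) (i : DoubleTerm) :
    AnalyticAt ℂ (doubleStart i) p := by
  have hx : AnalyticAt ℂ (fun q : ℂ × ℂ => q.1) p := analyticAt_fst
  have hy : AnalyticAt ℂ (fun q : ℂ × ℂ => q.2) p := analyticAt_snd
  have hxy : AnalyticAt ℂ (fun q : ℂ × ℂ => q.1 * q.2) p := hx.mul hy
  have nxy := norm_mul_lt_one_of_lt hp.1 hp.2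
  have slit : ∀ {z : ℂ}, ‖z‖ < 1 → 1 - z ∈ Complex.slitPlane := fun hz =>
    one_sub_mem_slitPlane hz.le (ne_one_of_norm_lt hz)
  have li : ∀ {f : ℂ × ℂ → ℂ}, AnalyticAt ℂ f p → ‖f p‖ < 1 →
      AnalyticAt ℂ (fun q => polylogSeries 2 (f q)) p := fun {f} hf h =>
    AnalyticAt.comp (f := f) (x := p) (analyticAt_polylogSeries h 1) hf
  cases i
  · exact (analyticAt_const.sub hx).clog (slit hp.1)
  · exact (analyticAt_const.sub hy).clog (slit hp.2)
  · exact (analyticAt_const.sub hxy).clog (slit nxy)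
  · exact li hx hp.1
  · exact li hy hp.2
  · exact li hxy nxy
  · exact analyticAt_doublePolylogSeries hp 1 1
  · exact analyticAt_doublePolylogSeries hp 1 2
  · exact analyticAt_doublePolylogSeries hp 2 1

/-- The single-valued version of `Li_{2,1}`, defined by its expression through the single-valued
trilogarithm; the arguments are `(y, x)`. -/
def svLi21 (p : ℂ × ℂ) : ℝ :=
  svTrilog (1 - p.2 * p.1) + svTrilog (1 - p.2) - svTrilog ((1 - p.2) / (1 - p.2 * p.1))
    - svTrilog p.1 + svTrilog ((p.1 - p.2 * p.1) / (1 - p.2 * p.1)) - svTrilog 1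

/-- The single-valued version of `Li_{1,2}`, defined by the single-valued stuffle relation. -/
def svLi12 (p : ℂ × ℂ) : ℝ := -svLi21 p.swap - svTrilog (p.1 * p.2)

theorem swap_mem_S₂ {x y : ℂ} (hp : (x, y) ∈ S₂) : (y, x) ∈ S₂ := by
  obtain ⟨hx0, hy0, hx1, hy1, hxy⟩ := mem_S₂_iff.1 hp
  exact mem_S₂_iff.2 ⟨hy0, hx0, hy1, hx1, by rwa [mul_comm]⟩

theorem AnalyticAt.svTrilog {f : ℂ × ℂ → ℂ} {p : ℂ × ℂ} (hf : AnalyticAt ℝ f p) (h0 : f p ≠ 0)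
    (h1 : f p ≠ 1) : AnalyticAt ℝ (fun q => svTrilog (f q)) p :=
  AnalyticAt.comp (f := f) (x := p) (analyticAt_svTrilog h0 h1) hf

theorem analyticAt_svLi21 {p : ℂ × ℂ} (hp : p ∈ S₂) : AnalyticAt ℝ svLi21 p := by
  obtain ⟨y, x⟩ := p
  obtain ⟨hy0, hx0, hy1, hx1, hyx⟩ := mem_S₂_iff.1 hp
  have one : AnalyticAt ℝ (fun _ : ℂ × ℂ => (1 : ℂ)) (y, x) := analyticAt_const
  have hx : AnalyticAt ℝ (fun q : ℂ × ℂ => q.2) (y, x) := analyticAt_snd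
  have hy : AnalyticAt ℝ (fun q : ℂ × ℂ => q.1) (y, x) := analyticAt_fst
  have h1x : 1 - x ≠ 0 := sub_ne_zero.2 hx1.symm
  have h1y : 1 - y ≠ 0 := sub_ne_zero.2 hy1.symm
  have h1xy : 1 - x * y ≠ 0 := sub_ne_zero.2 (by rw [mul_comm]; exact hyx.symm)
  have hq := (one.sub hx).div (one.sub (hx.mul hy)) h1xy
  have hr := (hy.sub (hx.mul hy)).div (one.sub (hx.mul hy)) h1xy
  refine ((((((one.sub (hx.mul hy)).svTrilog h1xy ?_).add
    ((one.sub hx).svTrilog h1x ?_)).sub (hq.svTrilog (div_ne_zero h1x h1xy) ?_)).sub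
    (hy.svTrilog hy0 hy1)).add (hr.svTrilog (div_ne_zero ?_ h1xy) ?_)).sub analyticAt_const
  · simp [hx0, hy0]
  · simpa using hx0
  · simp only [Pi.div_apply, Pi.sub_apply, Pi.mul_apply]
    rw [ne_eq, div_eq_one_iff_eq h1xy, ← sub_eq_zero]
    have : 1 - x - (1 - x * y) = -(x * (1 - y)) := by ring
    rw [this]
    exact neg_ne_zero.2 (mul_ne_zero hx0 h1y)
  · have : y - x * y = (1 - x) * y := by ring
    simp only [Pi.sub_apply, Pi.mul_apply]
    rw [this]
    exact mul_ne_zero h1x hy0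
  · simp only [Pi.div_apply, Pi.sub_apply, Pi.mul_apply]
    rw [ne_eq, div_eq_one_iff_eq h1xy, ← sub_eq_zero]
    have : y - x * y - (1 - x * y) = -(1 - y) := by ring
    rw [this]
    exact neg_ne_zero.2 h1y

theorem isOpen_fiveTermRegion : IsOpen fiveTermRegion := by
  have h1 : IsOpen {p : ℂ × ℂ | p.1 ≠ 0} := isOpen_ne_fun (by fun_prop) (by fun_prop)
  have h2 : IsOpen {p : ℂ × ℂ | p.2 ≠ 0} := isOpen_ne_fun (by fun_prop) (by fun_prop)
  have h3 : IsOpen {p : ℂ × ℂ | ‖p.1‖ < 1} := isOpen_lt (by fun_prop) (by fun_prop)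
  have h4 : IsOpen {p : ℂ × ℂ | ‖p.2‖ < 1} := isOpen_lt (by fun_prop) (by fun_prop)
  have h5 : IsOpen {p : ℂ × ℂ | ‖1 - p.1‖ < 1} := isOpen_lt (by fun_prop) (by fun_prop)
  have h6 : IsOpen {p : ℂ × ℂ | ‖1 - p.1 * p.2‖ < 1} := isOpen_lt (by fun_prop) (by fun_prop)
  have h7 : IsOpen {p : ℂ × ℂ | ‖1 - p.1‖ < ‖1 - p.1 * p.2‖} :=
    isOpen_lt (by fun_prop) (by fun_prop)
  exact h1.inter (h2.inter (h3.inter (h4.inter (h5.inter (h6.inter h7)))))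

/-- On `fiveTermRegion` this is the functional equation of the power series; the rest of the
polydisc is reached by the identity theorem. -/
theorem svLi21_eq_expr21 {p : ℂ × ℂ} (hp : p ∈ S₂) (hpd : p ∈ polydisc) :
    svLi21 p = expr21 p fun i => doubleStart i p := by
  have hG : AnalyticOnNhd ℝ (fun p => expr21 p fun i => doubleStart i p) (S₂ ∩ polydisc) :=
    fun q hq => (analyticAt_expr q hq.1 doubleStart
      fun i => (analyticAt_doubleStart hq.2 i).restrictScalars).2
  have hF : AnalyticOnNhd ℝ svLi21 (S₂ ∩ polydisc) := fun q hq => analyticAt_svLi21 hq.1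
  have hbase : ((1 / 2, 1 / 2) : ℂ × ℂ) ∈ S₂ ∩ polydisc := by
    refine ⟨mem_S₂_iff.2 ?_, ?_, ?_⟩ <;> norm_num
  have hregion : ((1 / 2, 1 / 2) : ℂ × ℂ).swap ∈ fiveTermRegion := by
    refine ⟨?_, ?_, ?_, ?_, ?_, ?_, ?_⟩ <;> norm_num
  refine hF.eqOn_of_preconnected_of_eventuallyEq hG isPreconnected_S₂_inter_polydisc hbase ?_
    ⟨hp, hpd⟩
  filter_upwards [(isOpen_fiveTermRegion.preimage continuous_swap).mem_nhds hregion] with q hq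
  obtain ⟨y, x⟩ := q
  have hq' : (x, y) ∈ fiveTermRegion := hq
  obtain ⟨h1, h2⟩ := fiveTermRegion_norm_div_lt hq'
  have heq := polydiscLi21_eq_discTrilog hq'
  obtain ⟨hx0, hy0, hx, hy, h1x, h1xy, -⟩ := hq'
  rw [expr21_eq_polydiscLi21 hx0 hy0 hx hy, heq]
  have n1 : ‖1 - x‖ ≤ 1 := le_of_lt h1x
  have n2 : ‖1 - x * y‖ ≤ 1 := le_of_lt h1xy
  have n3 : ‖y‖ ≤ 1 := le_of_lt hy
  simp only [svLi21, svTrilog_of_norm_le n1, svTrilog_of_norm_le n2, svTrilog_of_norm_le n3,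
    svTrilog_of_norm_le h1.le, svTrilog_of_norm_le h2.le, svTrilog_of_norm_le norm_one.le]

/-- The single-valued stuffle relation, from the stuffle products
`Li₁(x) Li₂(y) = Li_{1,2}(x, y) + Li_{2,1}(y, x) + Li₃(x y)` and
`Li₁(x) Li₁(y) = Li_{1,1}(x, y) + Li_{1,1}(y, x) + Li₂(x y)`. -/
theorem expr12_add_expr21_add_discTrilog {x y : ℂ} (hS : (x, y) ∈ S₂) (hx : ‖x‖ < 1)
    (hy : ‖y‖ < 1) :
    (expr12 (x, y) fun i => doubleStart i (x, y)) + (expr21 (y, x) fun i => doubleStart i (y, x))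
      + discTrilog (x * y) = 0 := by
  obtain ⟨hx0, hy0, hx1, hy1, hxy1⟩ := mem_S₂_iff.1 hS
  have n : ∀ {z : ℂ}, z ≠ 0 → ‖z‖ ≠ 0 := norm_ne_zero_iff.2
  have h1x : 1 - x ≠ 0 := sub_ne_zero.2 hx1.symm
  have s1 := congrArg Complex.re
    (polylogSeries_mul_polylogSeries hx hy one_ne_zero (two_ne_zero : (2 : ℕ) ≠ 0))
  have s2 := congrArg Complex.re
    (polylogSeries_mul_polylogSeries hx hy one_ne_zero (one_ne_zero : (1 : ℕ) ≠ 0))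
  rw [polylogSeries_one hx] at s1 s2
  rw [polylogSeries_one hy] at s2
  simp only [Complex.mul_re, Complex.neg_re, Complex.neg_im, Complex.add_re, Complex.log_re,
    Nat.reduceAdd] at s1 s2
  have l1 : Real.log ‖1 - x⁻¹‖ = Real.log ‖1 - x‖ - Real.log ‖x‖ := log_norm_one_sub_inv hx0 h1x
  have l2 : Real.log ‖x * y ^ 2‖ = Real.log ‖x‖ + 2 * Real.log ‖y‖ := by
    rw [norm_mul, norm_pow, Real.log_mul (n hx0) (pow_ne_zero 2 (n hy0)), Real.log_pow]
    push_cast; ring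
  have l3 : Real.log ‖x * y‖ = Real.log ‖x‖ + Real.log ‖y‖ := by
    rw [norm_mul, Real.log_mul (n hx0) (n hy0)]
  rw [expr21_eq_polydiscLi21 hx0 hy0 hx hy, polydiscLi21, discTrilog_eq]
  simp only [expr12, doubleStart, discDilog, dilogExpr]
  rw [l1, l2, l3]
  linear_combination -s1 + Real.log ‖y‖ * s2

theorem isSingleValuedLi21_svLi21 : IsSingleValuedLi21 svLi21 :=
  isSingleValued_of_eqOn isOpen_polydisc isOpen_S₂
    (fun p hp g hg => (analyticAt_expr p hp g fun i => (hg i).restrictScalars).2)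
    (fun _ hp => analyticAt_svLi21 hp) fun _ hp hpd => svLi21_eq_expr21 hp hpd

theorem isSingleValuedLi12_svLi12 : IsSingleValuedLi12 svLi12 := by
  refine isSingleValued_of_eqOn isOpen_polydisc isOpen_S₂
    (fun p hp g hg => (analyticAt_expr p hp g fun i => (hg i).restrictScalars).1)
    (fun p hp => ?_) fun p hp hpd => ?_
  · obtain ⟨x, y⟩ := p
    have hswap : AnalyticAt ℝ (fun q : ℂ × ℂ => q.swap) (x, y) := analyticAt_snd.prod analyticAt_fst
    have h1 : AnalyticAt ℝ (fun q : ℂ × ℂ => svLi21 q.swap) (x, y) :=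
      AnalyticAt.comp (f := fun q : ℂ × ℂ => q.swap) (x := (x, y)) (analyticAt_svLi21 (swap_mem_S₂ hp))
        hswap
    obtain ⟨hx0, hy0, -, -, hxy1⟩ := mem_S₂_iff.1 hp
    exact h1.neg.sub ((analyticAt_fst.mul analyticAt_snd).svTrilog (mul_ne_zero hx0 hy0) hxy1)
  · obtain ⟨x, y⟩ := p
    have h := expr12_add_expr21_add_discTrilog hp hpd.1 hpd.2
    have h21 := svLi21_eq_expr21 (p := (y, x)) (swap_mem_S₂ hp) ⟨hpd.2, hpd.1⟩
    have h3 := svTrilog_of_norm_le (norm_mul_lt_one_of_lt hpd.1 hpd.2).le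
    simp only [svLi12, Prod.swap_prod_mk]
    rw [h21, h3]
    linarith

theorem S₂_inter_polydisc_nonempty : (S₂ ∩ polydisc).Nonempty :=
  ⟨(1 / 2, 1 / 2), mem_S₂_iff.2 (by norm_num), by norm_num, by norm_num⟩

/-- By continuity, the uniqueness extends to the points `0` and `1`. -/
theorem IsSingleValuedTrilog.eq_svTrilog {L : ℂ → ℝ} (hL : IsSingleValuedTrilog L) :
    L = svTrilog := by
  have hset : {z : ℂ | z ≠ 0 ∧ z ≠ 1} = ({0, 1} : Set ℂ)ᶜ := by ext; simp
  have hc : ({0, 1} : Set ℂ).Countable := (Set.toFinite _).countable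
  have hpre : IsPreconnected {z : ℂ | z ≠ 0 ∧ z ≠ 1} := by
    rw [hset]
    exact (hc.isPathConnected_compl_of_one_lt_rank
      (by simp [Complex.rank_real_complex])).isConnected.isPreconnected
  have heq := hL.1.eqOn isSingleValuedTrilog_svTrilog.1 (isOpen_ne.inter isOpen_ne)
    (isOpen_lt continuous_norm continuous_const) hpre
    ⟨1 / 2, ⟨by norm_num, by norm_num⟩, by norm_num⟩ fun p hp i => analyticAt_trilogStart hp i
  have hdense : Dense {z : ℂ | z ≠ 0 ∧ z ≠ 1} := by
    rw [hset]; exact hc.dense_compl ℝ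
  exact Continuous.ext_on hdense hL.2 continuous_svTrilog heq

end

theorem mainTheorem8 :
    (∃ L₃ : ℂ → ℝ, IsSingleValuedTrilog L₃) ∧
    (∃ L₁₂ : ℂ × ℂ → ℝ, IsSingleValuedLi12 L₁₂) ∧
    (∃ L₂₁ : ℂ × ℂ → ℝ, IsSingleValuedLi21 L₂₁) ∧
    ∀ (L₃ : ℂ → ℝ) (L₁₂ L₂₁ : ℂ × ℂ → ℝ),
      IsSingleValuedTrilog L₃ → IsSingleValuedLi12 L₁₂ → IsSingleValuedLi21 L₂₁ →
      ∀ x y : ℂ, (x, y) ∈ S₂ →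
        L₁₂ (x, y) + L₂₁ (y, x) + L₃ (x * y) = 0 ∧
        L₂₁ (y, x) = L₃ (1 - x * y) + L₃ (1 - x) - L₃ ((1 - x) / (1 - x * y))
          - L₃ y + L₃ ((y - x * y) / (1 - x * y)) - L₃ 1 := by
  refine ⟨⟨_, isSingleValuedTrilog_svTrilog⟩, ⟨_, isSingleValuedLi12_svLi12⟩,
    ⟨_, isSingleValuedLi21_svLi21⟩, fun L₃ L₁₂ L₂₁ h₃ h₁₂ h₂₁ x y hxy => ?_⟩
  have e₁₂ : L₁₂ (x, y) = svLi12 (x, y) := IsSingleValued.eqOn h₁₂ isSingleValuedLi12_svLi12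
    isOpen_S₂ isOpen_polydisc isPreconnected_S₂ S₂_inter_polydisc_nonempty
    (fun _ hp i => analyticAt_doubleStart hp i) hxy
  have e₂₁ : L₂₁ (y, x) = svLi21 (y, x) := IsSingleValued.eqOn h₂₁ isSingleValuedLi21_svLi21
    isOpen_S₂ isOpen_polydisc isPreconnected_S₂ S₂_inter_polydisc_nonempty
    (fun _ hp i => analyticAt_doubleStart hp i) (swap_mem_S₂ hxy)
  rw [h₃.eq_svTrilog, e₁₂, e₂₁]
  refine ⟨?_, rfl⟩
  simp only [svLi12, Prod.swap_prod_mk]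
  ring
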